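/- A cyclically ordered group is a (not necessarily abelian) group $G$ with a ternary relation $R$ such that: $R(a,b,c)$ implies that $a,b,c$ are pairwise distinct; $R(a,b,c)$ implies $R(b,c,a)$; for each $g\in G$ the relation $R(g,\cdot,\cdot)$ is a strict linear order on $G\setminus\{g\}$; and $R(a,b,c)$ implies $R(hah',hbh',hch')$ for all $h,h'\in G$. It is regarded as a first-order structure in the language $\{\cdot,R,e,{}^{-1}\}$. An open interval of $G$ is a set $I(g,g')=\{h\in G : R(g,h,g')\}$ with $g\neq g'$. An infinite cyclically ordered group $(G,R)$ is called cyclically minimal if each subset of $G$ that is definable with parameters is a finite union of singletons and open intervals. It is called strongly cyclically minimal if each cyclically ordered group $(G',R')$ that is elementarily equivalent to $(G,R)$ is cyclically minimal. (A finite cyclically ordered group is neither.) Corollary 1.6 (Lucas). A cyclically ordered group is strongly cyclically minimal if and only if it is cyclically minimal. -/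

import Mathlib

universe u v

/-- A cyclically ordered group: a group with a ternary relation `R` which is strict, cyclic,
compatible with left and right translations, and such that for each fixed `g` the relation
`R g · ·` is a strict linear order on `G \ {g}`. -/
class CyclicallyOrderedGroup (G : Type u) extends Group G where
  /-- The cyclic order. -/
  R : G → G → G → Prop
  strict : ∀ a b c : G, R a b c → a ≠ b ∧ b ≠ c ∧ c ≠ a
  cyclic : ∀ a b c : G, R a b c → R b c a
  linear : ∀ g : G, IsStrictTotalOrder {x : G // x ≠ g} (fun x y => R g x y)
  compat : ∀ a b c h k : G, R a b c → R (h * a * k) (h * b * k) (h * c * k)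

namespace CyclicallyOrderedGroup

/-- The function symbols of the language of cyclically ordered groups. -/
inductive FuncSymb : ℕ → Type
  | one : FuncSymb 0
  | inv : FuncSymb 1
  | mul : FuncSymb 2

/-- The relation symbols of the language of cyclically ordered groups. -/
inductive RelSymb : ℕ → Type
  | cyc : RelSymb 3

/-- The first-order language `{·, R, e, ⁻¹}` of cyclically ordered groups. -/
def lang : FirstOrder.Language.{0, 0} where
  Functions := FuncSymb
  Relations := RelSymb

/-- A cyclically ordered group as a first-order structure. -/
instance instStructure (G : Type u) [CyclicallyOrderedGroup G] : lang.Structure G where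
  funMap := fun {_} f =>
    match f with
    | .one => fun _ => 1
    | .inv => fun x => (x 0)⁻¹
    | .mul => fun x => x 0 * x 1
  RelMap := fun {_} r =>
    match r with
    | .cyc => fun x => R (x 0) (x 1) (x 2)

/-- The set `I(a, b)` of all `h` with `R(a, h, b)`. -/
def interval {G : Type u} [CyclicallyOrderedGroup G] (a b : G) : Set G :=
  {h : G | R a h b}

/-- An open interval is a set `I(a, b)` with `a ≠ b`. -/
def IsOpenInterval {G : Type u} [CyclicallyOrderedGroup G] (I : Set G) : Prop :=
  ∃ a b : G, a ≠ b ∧ I = interval a b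

/-- `D` is the union of a finite family of sets, each a singleton or an open interval. -/
def IsFiniteUnion {G : Type u} [CyclicallyOrderedGroup G] (D : Set G) : Prop :=
  ∃ F : Set (Set G), F.Finite ∧ (∀ I ∈ F, (∃ g : G, I = {g}) ∨ IsOpenInterval I) ∧ D = ⋃₀ F

/-- A cyclically ordered group is cyclically minimal if it is infinite and each subset definable
with parameters is a finite union of singletons and open intervals. -/
def IsCyclicallyMinimal (G : Type u) [CyclicallyOrderedGroup G] : Prop :=
  Infinite G ∧ ∀ D : Set G, (Set.univ : Set G).Definable₁ lang D → IsFiniteUnion D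

/-- A cyclically ordered group is strongly cyclically minimal if it is infinite and every
cyclically ordered group which is elementarily equivalent to it is cyclically minimal. The
universe `v` of the elementarily equivalent groups is independent of that of `G`. -/
def IsStronglyCyclicallyMinimal (G : Type u) [CyclicallyOrderedGroup G] : Prop :=
  Infinite G ∧ ∀ (G' : Type v) [CyclicallyOrderedGroup G'],
    lang.ElementarilyEquivalent G G' → IsCyclicallyMinimal G'

end CyclicallyOrderedGroup

/-! Cyclic minimality is equivalent to a list of first-order properties, `IsDivisibleWithTorsion`:
commutativity, divisibility, and the existence of elements of each prime order. Such a list passes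
between elementarily equivalent groups, so the strong and the plain notion agree.

Cyclic and linear order are linked by the unwound group `Unwound G`, a linearly ordered central
extension of `G` by `ℤ` in which `period` is one full turn.

A minimal group satisfies the list. By `IsCyclicallyMinimal.isDense` its order has no gaps, and then
definable sets cannot disconnect it (`mem_iff_of_locally_const`). An infinite definable subgroup
contains an interval, hence is open, hence is everything; centralizers and groups of `n`-th powers
give commutativity and divisibility. Torsion comes from connectedness of the complement of `1`:
without `n`-torsion, the set where `n • lift x < period` would be clopen there.

Conversely, the list makes `Unwound G` a divisible ordered abelian group. Quantifiers are eliminated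
by matching the order pattern of the roots of finitely many affine functions
(`exists_sameSign_matching`, `IsDivisibleWithTorsion.exists_sign_determined`). With parameters
fixed, membership in a definable subset of `G` depends on the signs of finitely many functions `c +
k • y`, so away from `1` it changes only at their roots. -/

namespace CyclicallyOrderedGroup

/-! ### Cyclic orders and the linear order obtained by cutting at `1`. -/

section CyclicOrder

variable {G : Type u} [CyclicallyOrderedGroup G] {a b c d : G}

theorem R_ne (h : R a b c) : a ≠ b ∧ b ≠ c ∧ c ≠ a := strict a b c h

theorem R_rot (h : R a b c) : R b c a := cyclic a b c h

theorem R_asymm (h : R a b c) : ¬ R a c b := by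
  intro h'
  have hl := linear a
  obtain ⟨h1, -, h3⟩ := R_ne h
  exact hl.toIsStrictOrder.toIrrefl.irrefl ⟨b, h1.symm⟩
    (hl.toIsStrictOrder.toIsTrans.trans ⟨b, h1.symm⟩ ⟨c, h3⟩ ⟨b, h1.symm⟩ h h')

theorem R_trans (h : R a b c) (h' : R a c d) : R a b d := by
  obtain ⟨h1, -, h3⟩ := R_ne h
  exact (linear a).toIsStrictOrder.toIsTrans.trans ⟨b, h1.symm⟩ ⟨c, h3⟩
    ⟨d, (R_ne h').2.2⟩ h h'

theorem R_total (h1 : a ≠ b) (h2 : b ≠ c) (h3 : a ≠ c) : R a b c ∨ R a c b := by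
  have := (linear a).toTrichotomous.trichotomous ⟨b, h1.symm⟩ ⟨c, h3.symm⟩
  by_contra! hn
  exact h2 (by simpa using this hn.1 hn.2)

theorem R_left (g : G) (h : R a b c) : R (g * a) (g * b) (g * c) := by
  simpa using compat a b c g 1 h

theorem R_right (g : G) (h : R a b c) : R (a * g) (b * g) (c * g) := by
  simpa using compat a b c 1 g h

theorem R_left_iff (g : G) : R (g * a) (g * b) (g * c) ↔ R a b c :=
  ⟨fun h => by simpa using R_left g⁻¹ h, R_left g⟩

theorem R_right_iff (g : G) : R (a * g) (b * g) (c * g) ↔ R a b c :=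
  ⟨fun h => by simpa using R_right g⁻¹ h, R_right g⟩

/-- Inversion reverses the linear order `R 1`. -/
theorem R_inv (h : R 1 a b) : R 1 b⁻¹ a⁻¹ := by
  obtain ⟨h1, h2, h3⟩ := R_ne h
  by_contra hn
  have h4 : R 1 a⁻¹ b⁻¹ := by
    refine (R_total ?_ ?_ ?_).resolve_right hn
    · simpa [eq_comm] using h1
    · simpa using h2
    · simpa [eq_comm] using h3
  -- Translates of `h` and of the assumed `h4` place `a` and `b⁻¹` in both possible orders after
  -- `1`.
  have e1 : R a⁻¹ 1 (a⁻¹ * b) := by simpa using R_left a⁻¹ h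
  have e2 : R b (a⁻¹ * b) 1 := by simpa using R_right b h4
  have e3 : R a 1 (a * b⁻¹) := by simpa using R_left a h4
  have e4 : R b⁻¹ (a * b⁻¹) 1 := by simpa using R_right b⁻¹ h
  have e5 : R 1 b⁻¹ a := R_trans (R_rot (R_rot e4)) (R_rot e3)
  have e6 : R 1 a b⁻¹ :=
    R_trans h (R_trans (R_rot (R_rot e2)) (R_trans (R_rot e1) h4))
  exact R_asymm e5 e6

/-- The linear order on `G` with least element `1` induced by `R`. -/
def Below (a b : G) : Prop := (a = 1 ∧ b ≠ 1) ∨ R 1 a b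

theorem Below.irrefl (a : G) : ¬ Below a a := by
  rintro (h | h)
  · exact h.2 h.1
  · exact (R_ne h).2.1 rfl

theorem Below.trans (h : Below a b) (h' : Below b c) : Below a c := by
  rcases h with ⟨rfl, h⟩ | h <;> rcases h' with ⟨rfl, h'⟩ | h'
  · exact absurd rfl h
  · exact Or.inl ⟨rfl, (R_ne h').2.2⟩
  · exact absurd rfl (R_ne h).2.2
  · exact Or.inr (R_trans h h')

theorem Below.total (h : a ≠ b) : Below a b ∨ Below b a := by
  by_cases ha : a = 1
  · exact Or.inl (Or.inl ⟨ha, fun hb => h (ha.trans hb.symm)⟩)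
  by_cases hb : b = 1
  · exact Or.inr (Or.inl ⟨hb, ha⟩)
  rcases R_total (Ne.symm ha) h (Ne.symm hb) with h | h
  · exact Or.inl (Or.inr h)
  · exact Or.inr (Or.inr h)

theorem Below.asymm (h : Below a b) : ¬ Below b a := fun h' => Below.irrefl a (h.trans h')

theorem not_below_one (a : G) : ¬ Below a 1 := by
  rintro (h | h)
  · exact h.2 rfl
  · exact (R_ne h).2.2 rfl

theorem one_below (h : a ≠ 1) : Below 1 a := Or.inl ⟨rfl, h⟩

theorem below_iff (h : a ≠ 1) : Below a b ↔ R 1 a b := by simp [Below, h]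

/-- Cutting the circle at `1` loses nothing: a triple is positively oriented exactly when some
rotation of it is increasing. -/
theorem R_iff_below :
    R a b c ↔ (Below a b ∧ Below b c) ∨ (Below b c ∧ Below c a) ∨ (Below c a ∧ Below a b) := by
  have key : ∀ {a b c : G}, Below a b → Below b c → R a b c := by
    intro a b c h h'
    rcases h with ⟨rfl, h⟩ | h
    · exact (below_iff h).1 h'
    · have h' := (below_iff (R_ne h).2.2).1 h'
      exact R_rot (R_rot (R_trans (R_rot h') (R_rot (R_rot h))))
  constructor
  · intro h
    obtain ⟨h1, h2, h3⟩ := R_ne h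
    rcases Below.total h1 with x | x <;> rcases Below.total h2 with y | y <;>
      rcases Below.total h3 with z | z
    · exact Or.inl ⟨x, y⟩
    · exact Or.inl ⟨x, y⟩
    · exact Or.inr (Or.inr ⟨z, x⟩)
    · exact absurd (key z y) (R_asymm h)
    · exact Or.inr (Or.inl ⟨y, z⟩)
    · exact absurd (R_rot (key x z)) (R_asymm h)
    · exact absurd (R_rot (R_rot (key y x))) (R_asymm h)
    · exact absurd (R_rot (R_rot (key y x))) (R_asymm h)
  · rintro (⟨h, h'⟩ | ⟨h, h'⟩ | ⟨h, h'⟩)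
    · exact key h h'
    · exact R_rot (R_rot (key h h'))
    · exact R_rot (key h h')

/-- `a * b` wraps around past `1`, from either side. -/
theorem mul_below_comm (a b : G) : Below (b * a) b ↔ Below (b * a) a := by
  by_cases ha : a = 1
  · subst ha; simp [Below.irrefl, not_below_one]
  by_cases hb : b = 1
  · subst hb; simp [Below.irrefl, not_below_one]
  by_cases hab : b * a = 1
  · simp [hab, one_below ha, one_below hb]
  have ha' : (1 : G) ≠ a := Ne.symm ha
  have hb' : (1 : G) ≠ b := Ne.symm hb
  have hab' : (1 : G) ≠ b * a := Ne.symm hab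
  rw [below_iff hab, below_iff hab]
  have l1 : R 1 (b * a) b ↔ R 1 b⁻¹ a := by
    rw [← R_left_iff b⁻¹]; simp only [mul_one, inv_mul_cancel_left, inv_mul_cancel]
    exact ⟨fun h => R_rot (R_rot h), R_rot⟩
  have l2 : R 1 (b * a) a ↔ R 1 a⁻¹ b := by
    rw [← R_right_iff a⁻¹]; simp only [one_mul, mul_inv_cancel_right, mul_inv_cancel]
    exact ⟨fun h => R_rot (R_rot h), R_rot⟩
  rw [l1, l2]
  exact ⟨fun h => by simpa using R_inv h, fun h => by simpa using R_inv h⟩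

end CyclicOrder

end CyclicallyOrderedGroup

/-! ### The unwound group: carries, cocycle identity, invariant order. -/

namespace CyclicallyOrderedGroup

open Classical in
/-- The number of turns (`0` or `1`) made when adding the representatives of `a` and `b`. -/
noncomputable def wrap {G : Type u} [CyclicallyOrderedGroup G] (a b : G) : ℤ :=
  if Below (a * b) a then 1 else 0

/-- The lexicographic order on `ℤ × G`. -/
def LexLT {G : Type u} [CyclicallyOrderedGroup G] (m : ℤ) (a : G) (n : ℤ) (b : G) : Prop :=
  m < n ∨ (m = n ∧ Below a b)

section Wrap

variable {G : Type u} [CyclicallyOrderedGroup G] {a b c d : G}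

theorem wrap_eq_zero_or (a b : G) :
    (wrap a b = 0 ∧ ¬ Below (a * b) a ∧ ¬ Below (a * b) b) ∨
      (wrap a b = 1 ∧ Below (a * b) a ∧ Below (a * b) b) := by
  have := mul_below_comm b a
  unfold wrap
  split_ifs with h <;> tauto

theorem wrap_one_left (b : G) : wrap 1 b = 0 := by simp [wrap, not_below_one]

theorem wrap_one_right (a : G) : wrap a 1 = 0 := by simp [wrap, Below.irrefl]

/-- Translation by `a` turns the order cut at `1` into the order cut at `a`; the carry records which
points have then passed `1`. -/
theorem lexLT_wrap_left (a : G) (h : Below b c) : LexLT (wrap a b) (a * b) (wrap a c) (a * c) := by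
  by_cases ha : a = 1
  · subst ha; simpa [LexLT, wrap_one_left] using h
  have hbc : a * b ≠ a * c := fun e => Below.irrefl b (by rwa [← mul_left_cancel e] at h)
  rcases h with ⟨rfl, h⟩ | h
  · rw [wrap_one_right, mul_one]
    rcases wrap_eq_zero_or a c with ⟨e, h1, -⟩ | ⟨e, h1, -⟩
    · exact Or.inr ⟨e.symm, (Below.total (by simpa using hbc)).resolve_right h1⟩
    · exact Or.inl (by omega)
  · have h' : R a (a * b) (a * c) := by simpa using R_left a h
    rw [R_iff_below] at h'
    rcases wrap_eq_zero_or a b with ⟨e, h1, -⟩ | ⟨e, h1, -⟩ <;>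
    rcases wrap_eq_zero_or a c with ⟨e', h2, -⟩ | ⟨e', h2, -⟩
    · exact Or.inr ⟨by omega, by grind⟩
    · exact Or.inl (by omega)
    · exfalso
      have := h1.asymm
      grind
    · refine Or.inr ⟨by omega, ?_⟩
      have := h1.asymm
      have := h2.asymm
      grind

theorem lexLT_wrap_right (a : G) (h : Below b c) : LexLT (wrap b a) (b * a) (wrap c a) (c * a) := by
  by_cases ha : a = 1
  · subst ha; simpa [LexLT, wrap_one_right] using h
  have hbc : b * a ≠ c * a := fun e => Below.irrefl b (by rwa [← mul_right_cancel e] at h)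
  rcases h with ⟨rfl, h⟩ | h
  · rw [wrap_one_left, one_mul]
    rcases wrap_eq_zero_or c a with ⟨e, -, h1⟩ | ⟨e, -, h1⟩
    · exact Or.inr ⟨e.symm, (Below.total (by simpa using hbc)).resolve_right h1⟩
    · exact Or.inl (by omega)
  · have h' : R a (b * a) (c * a) := by simpa using R_right a h
    rw [R_iff_below] at h'
    rcases wrap_eq_zero_or b a with ⟨e, -, h1⟩ | ⟨e, -, h1⟩ <;>
    rcases wrap_eq_zero_or c a with ⟨e', -, h2⟩ | ⟨e', -, h2⟩
    · exact Or.inr ⟨by omega, by grind⟩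
    · exact Or.inl (by omega)
    · exfalso
      have := h1.asymm
      grind
    · refine Or.inr ⟨by omega, ?_⟩
      have := h1.asymm
      have := h2.asymm
      grind

theorem LexLT.mul_left {m n : ℤ} (a : G) (h : LexLT m b n c) :
    LexLT (m + wrap a b) (a * b) (n + wrap a c) (a * c) := by
  unfold LexLT at *
  rcases h with h | ⟨h, h'⟩
  · by_cases e : b = c
    · rw [e]; left; omega
    rcases Below.total e with h' | h'
    · have := lexLT_wrap_left a h'
      unfold LexLT at this
      rcases this with h | h
      · left; omega
      · left; omega
    · have h1 := wrap_eq_zero_or a b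
      have h2 := wrap_eq_zero_or a c
      have h3 := lexLT_wrap_left a h'
      unfold LexLT at h3
      rcases h1 with ⟨h1, h1', -⟩ | ⟨h1, -, -⟩ <;> rcases h2 with ⟨h2, h2', -⟩ | ⟨h2, -, -⟩
      · left; omega
      · left; omega
      -- Only `a * b` wraps. If the carry makes the turn counts equal, `a * b` lies before `a`, and
      -- `a * c` does not.
      · by_cases hh : m + 1 < n
        · left; omega
        right
        refine ⟨by omega, ?_⟩
        have h4 := (wrap_eq_zero_or a b).resolve_left (by omega)
        by_cases hx : a * c = a
        · rw [hx]; exact h4.2.1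
        exact h4.2.1.trans ((Below.total hx).resolve_left h2')
      · left; omega
  · have := lexLT_wrap_left a h'
    unfold LexLT at this
    rcases this with h | h
    · left; omega
    · right; exact ⟨by omega, h.2⟩

theorem LexLT.mul_right {m n : ℤ} (a : G) (h : LexLT m b n c) :
    LexLT (m + wrap b a) (b * a) (n + wrap c a) (c * a) := by
  unfold LexLT at *
  rcases h with h | ⟨h, h'⟩
  · by_cases e : b = c
    · rw [e]; left; omega
    rcases Below.total e with h' | h'
    · have := lexLT_wrap_right a h'
      unfold LexLT at this
      rcases this with h | h
      · left; omega
      · left; omega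
    · have h1 := wrap_eq_zero_or b a
      have h2 := wrap_eq_zero_or c a
      have h3 := lexLT_wrap_right a h'
      unfold LexLT at h3
      rcases h1 with ⟨h1, -, h1'⟩ | ⟨h1, -, -⟩ <;> rcases h2 with ⟨h2, -, h2'⟩ | ⟨h2, -, -⟩
      · left; omega
      · left; omega
      · by_cases hh : m + 1 < n
        · left; omega
        right
        refine ⟨by omega, ?_⟩
        have h4 := (wrap_eq_zero_or b a).resolve_left (by omega)
        by_cases hx : c * a = a
        · rw [hx]; exact h4.2.2
        exact h4.2.2.trans ((Below.total hx).resolve_left h2')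
      · left; omega
  · have := lexLT_wrap_right a h'
    unfold LexLT at this
    rcases this with h | h
    · left; omega
    · right; exact ⟨by omega, h.2⟩

/-- Both bracketings give a turn count for `a * b * c`. Translating `1 < c < one full turn` puts
each of them between `a * b` and the same point one turn later, and only one count fits there. -/
theorem wrap_cocycle (a b c : G) :
    wrap a b + wrap (a * b) c = wrap b c + wrap a (b * c) := by
  by_cases hc : c = 1
  · subst hc; simp [wrap_one_right]
  have l : LexLT 0 1 0 c := Or.inr ⟨rfl, one_below hc⟩
  have u : LexLT 0 c 1 1 := Or.inl one_pos
  have l1 := (l.mul_left b).mul_left a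
  have u1 := (u.mul_left b).mul_left a
  have l2 := l.mul_left (a * b)
  have u2 := u.mul_left (a * b)
  simp only [wrap_one_right, mul_one, ← mul_assoc] at l1 u1 l2 u2
  have h : Below (a * b) (a * b * c) → ¬ Below (a * b * c) (a * b) := Below.asymm
  unfold LexLT at l1 u1 l2 u2
  by_cases h' : Below (a * b) (a * b * c)
  · simp only [h', h h', and_true, and_false, or_false] at l1 u1 l2 u2
    omega
  · simp only [h', and_false, or_false] at l1 u1 l2 u2
    omega

end Wrap

/-- The unwound of a cyclically ordered group `G`: the linearly ordered central extension of `G`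
by `ℤ` whose quotient by `ℤ` carries the given cyclic order. -/
@[ext] structure Unwound (G : Type u) where
  /-- The number of turns. -/
  turn : ℤ
  /-- The image in `G`. -/
  val : G

namespace Unwound

variable {G : Type u} [CyclicallyOrderedGroup G]

noncomputable instance : Add (Unwound G) :=
  ⟨fun x y => ⟨x.turn + y.turn + wrap x.val y.val, x.val * y.val⟩⟩

noncomputable instance : Zero (Unwound G) := ⟨⟨0, 1⟩⟩

noncomputable instance : Neg (Unwound G) := ⟨fun x => ⟨-x.turn - wrap x.val⁻¹ x.val, x.val⁻¹⟩⟩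

@[simp] theorem add_turn (x y : Unwound G) :
    (x + y).turn = x.turn + y.turn + wrap x.val y.val := rfl

@[simp] theorem add_val (x y : Unwound G) : (x + y).val = x.val * y.val := rfl

@[simp] theorem zero_turn : (0 : Unwound G).turn = 0 := rfl

@[simp] theorem zero_val : (0 : Unwound G).val = 1 := rfl

@[simp] theorem neg_val (x : Unwound G) : (-x).val = x.val⁻¹ := rfl

noncomputable instance : AddGroup (Unwound G) :=
  AddGroup.ofLeftAxioms
    (by
      intro x y z
      ext
      · have := wrap_cocycle x.val y.val z.val
        simp only [add_turn, add_val]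
        omega
      · simp [mul_assoc])
    (by intro x; ext <;> simp [wrap_one_left])
    (by
      intro x
      ext
      · change -x.turn - wrap x.val⁻¹ x.val + x.turn + wrap x.val⁻¹ x.val = 0
        omega
      · simp)

open Classical in
noncomputable instance : LinearOrder (Unwound G) where
  lt x y := LexLT x.turn x.val y.turn y.val
  le x y := x = y ∨ LexLT x.turn x.val y.turn y.val
  le_refl x := Or.inl rfl
  le_trans x y z h h' := by
    rcases h with rfl | h
    · exact h'
    rcases h' with rfl | h'
    · exact Or.inr h
    right
    rcases h with h | ⟨h1, h2⟩ <;> rcases h' with h' | ⟨h1', h2'⟩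
    · exact Or.inl (by omega)
    · exact Or.inl (by omega)
    · exact Or.inl (by omega)
    · exact Or.inr ⟨by omega, h2.trans h2'⟩
  lt_iff_le_not_ge x y := by
    have : ∀ x y : Unwound G, LexLT x.turn x.val y.turn y.val →
        ¬ (y = x ∨ LexLT y.turn y.val x.turn x.val) := by
      rintro x y (h | h) (rfl | h' | h')
      · omega
      · omega
      · omega
      · exact Below.irrefl _ h.2
      · omega
      · exact h.2.asymm h'.2
    have h1 := this x y
    have h2 := this y x
    grind
  le_antisymm x y h h' := by
    rcases h with rfl | h
    · rfl
    rcases h' with rfl | h'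
    · rfl
    exfalso
    rcases h with h | h <;> rcases h' with h' | h'
    · omega
    · omega
    · omega
    · exact h.2.asymm h'.2
  le_total x y := by
    by_cases h : x = y
    · exact Or.inl (Or.inl h)
    rcases lt_trichotomy x.turn y.turn with h1 | h1 | h1
    · exact Or.inl (Or.inr (Or.inl h1))
    · have : x.val ≠ y.val := fun h2 => h (Unwound.ext h1 h2)
      rcases Below.total this with h2 | h2
      · exact Or.inl (Or.inr (Or.inr ⟨h1, h2⟩))
      · exact Or.inr (Or.inr (Or.inr ⟨h1.symm, h2⟩))
    · exact Or.inr (Or.inr (Or.inl h1))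
  toDecidableLE := Classical.decRel _

theorem lt_iff {x y : Unwound G} :
    x < y ↔ x.turn < y.turn ∨ (x.turn = y.turn ∧ Below x.val y.val) := Iff.rfl

theorem add_lt_left (x : Unwound G) {y z : Unwound G} (h : y < z) : x + y < x + z := by
  have := LexLT.mul_left x.val (lt_iff.1 h)
  rw [lt_iff]
  simp only [add_turn, add_val]
  rcases this with h | h
  · left; omega
  · right; exact ⟨by omega, h.2⟩

theorem add_lt_right (x : Unwound G) {y z : Unwound G} (h : y < z) : y + x < z + x := by
  have := LexLT.mul_right x.val (lt_iff.1 h)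
  rw [lt_iff]
  simp only [add_turn, add_val]
  rcases this with h | h
  · left; omega
  · right; exact ⟨by omega, h.2⟩

instance : AddLeftStrictMono (Unwound G) := ⟨fun x _ _ h => add_lt_left x h⟩

instance : AddRightStrictMono (Unwound G) := ⟨fun x _ _ h => add_lt_right x h⟩

instance : AddLeftMono (Unwound G) := addLeftMono_of_addLeftStrictMono _

instance : AddRightMono (Unwound G) := addRightMono_of_addRightStrictMono _

end Unwound

end CyclicallyOrderedGroup

/-! ### The period, representatives, and recovery of `R` from the unwound. -/

namespace CyclicallyOrderedGroup

namespace Unwound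

/-- The representative of an element of `G` in `[0, period)`. -/
def lift {G : Type u} (g : G) : Unwound G := ⟨0, g⟩

@[simp] theorem lift_val {G : Type u} (g : G) : (lift g).val = g := rfl

@[simp] theorem lift_turn {G : Type u} (g : G) : (lift g).turn = 0 := rfl

variable {G : Type u} [CyclicallyOrderedGroup G]

/-- One full turn. -/
def period : Unwound G := ⟨1, 1⟩

@[simp] theorem period_val : (period : Unwound G).val = 1 := rfl

@[simp] theorem period_turn : (period : Unwound G).turn = 1 := rfl

@[simp] theorem nsmul_val (n : ℕ) (x : Unwound G) : (n • x).val = x.val ^ n := by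
  induction n with
  | zero => simp
  | succ n ih => rw [succ_nsmul, add_val, ih, pow_succ]

@[simp] theorem zsmul_val (n : ℤ) (x : Unwound G) : (n • x).val = x.val ^ n := by
  cases n with
  | ofNat n => simp
  | negSucc n => simp [negSucc_zsmul]

theorem nsmul_period (n : ℕ) : n • (period : Unwound G) = ⟨n, 1⟩ := by
  induction n with
  | zero => rw [zero_smul]; rfl
  | succ n ih => rw [succ_nsmul, ih]; ext <;> simp [wrap_one_left]

theorem zsmul_period (n : ℤ) : n • (period : Unwound G) = ⟨n, 1⟩ := by
  cases n with
  | ofNat n => simpa using nsmul_period n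
  | negSucc n =>
    rw [negSucc_zsmul, nsmul_period, neg_eq_iff_add_eq_zero]
    ext
    · simp [wrap_one_left, Int.negSucc_eq]
    · simp

@[simp] theorem add_zsmul_period_turn (x : Unwound G) (n : ℤ) :
    (x + n • period).turn = x.turn + n := by simp [zsmul_period, wrap_one_right]

theorem period_addCommute (x : Unwound G) (n : ℤ) : AddCommute x (n • period) := by
  ext <;> simp [zsmul_period, wrap_one_right, wrap_one_left, add_comm]

theorem period_pos : (0 : Unwound G) < period := Or.inl one_pos

theorem val_eq_iff {x y : Unwound G} : x.val = y.val ↔ ∃ i : ℤ, x = y + i • period := by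
  constructor
  · intro h
    exact ⟨x.turn - y.turn, by ext <;> simp [-add_turn, h]⟩
  · rintro ⟨i, rfl⟩
    simp

theorem lift_nonneg (g : G) : 0 ≤ lift g := by
  by_cases h : g = 1
  · subst h; exact le_rfl
  · exact le_of_lt (Or.inr ⟨rfl, one_below h⟩)

theorem lift_lt_period (g : G) : lift g < period := Or.inl one_pos

theorem lift_lt_lift {g h : G} : lift g < lift h ↔ Below g h := by simp [lt_iff]

theorem lift_pos {g : G} : 0 < lift g ↔ g ≠ 1 := by
  simp only [lt_iff, zero_turn, lift_turn, lt_self_iff_false, zero_val, lift_val, true_and,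
    false_or]
  exact ⟨fun h e => not_below_one 1 (e ▸ h), one_below⟩

theorem lift_val_eq {x : Unwound G} (h : 0 ≤ x) (h' : x < period) : lift x.val = x := by
  have h1 : x.turn < 1 := by
    rcases h' with h' | ⟨-, h'⟩
    · exact h'
    · exact absurd h' (not_below_one _)
  have h2 : 0 ≤ x.turn := by
    by_contra hn
    exact absurd (Or.inl (by simpa using hn) : x < 0) (not_lt.2 h)
  ext
  · simp; omega
  · rfl

/-- This turns an atomic formula `R` into linear inequalities, at the cost of two unknown turn
counts. -/
theorem R_val_iff {x y z : Unwound G} : R x.val y.val z.val ↔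
    ∃ i j : ℤ, x < y + i • period ∧ y + i • period < z + j • period ∧
      z + j • period < x + period := by
  have e : ∀ a : Unwound G, a + period = a + (1 : ℤ) • period := by simp
  simp only [e, lt_iff, add_zsmul_period_turn, add_val, zsmul_val, period_val, one_zpow, mul_one]
  rw [R_iff_below]
  constructor
  · rintro (⟨h, h'⟩ | ⟨h, h'⟩ | ⟨h, h'⟩)
    · exact ⟨x.turn - y.turn, x.turn - z.turn, Or.inr ⟨by omega, h⟩, Or.inr ⟨by omega, h'⟩,
        Or.inl (by omega)⟩
    · exact ⟨x.turn - y.turn + 1, x.turn - z.turn + 1, Or.inl (by omega), Or.inr ⟨by omega, h⟩,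
        Or.inr ⟨by omega, h'⟩⟩
    · exact ⟨x.turn - y.turn, x.turn - z.turn + 1, Or.inr ⟨by omega, h'⟩, Or.inl (by omega),
        Or.inr ⟨by omega, h⟩⟩
  · rintro ⟨i, j, h1 | ⟨h1, h1'⟩, h2 | ⟨h2, h2'⟩, h3 | ⟨h3, h3'⟩⟩
    · omega
    · omega
    · omega
    · exact Or.inr (Or.inl ⟨h2', h3'⟩)
    · omega
    · exact Or.inr (Or.inr ⟨h3', h1'⟩)
    · exact Or.inl ⟨h1', h2'⟩
    · omega

/-- The unwound of a commutative group is commutative. -/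
noncomputable abbrev addCommGroup (h : ∀ a b : G, a * b = b * a) : AddCommGroup (Unwound G) :=
  { (inferInstance : AddGroup (Unwound G)) with
    add_comm := fun x y => by
      ext
      · have h1 := wrap_eq_zero_or x.val y.val
        have h2 := wrap_eq_zero_or y.val x.val
        rw [h x.val y.val] at h1
        simp only [add_turn]
        have : wrap x.val y.val = wrap y.val x.val := by grind
        omega
      · exact h _ _ }

theorem exists_nsmul_eq_zsmul_period {g : G} {n : ℕ} (h : g ^ n = 1) :
    ∃ k : ℤ, n • lift g = k • period := by
  refine ⟨(n • lift g).turn, ?_⟩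
  rw [zsmul_period]
  ext
  · rfl
  · simpa using h

end Unwound

open Unwound

/-! ### Torsion elements. -/

section Torsion

variable {G : Type u} [CyclicallyOrderedGroup G]

/-- Elements of finite order are central. -/
theorem torsion_central {g : G} {n : ℕ} (hn : n ≠ 0) (h : g ^ n = 1) (a : G) :
    a * g = g * a := by
  obtain ⟨k, hk⟩ := exists_nsmul_eq_zsmul_period h
  set x := lift g
  set y := lift a
  have h1 : AddSemiconjBy y x (y + x - y) := by simp [AddSemiconjBy]
  have h2 := h1.nsmul_right n
  -- `n • x` is a multiple of the central `period`, so conjugation fixes it; multiplication by `n`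
  -- is injective, so conjugation fixes `x` too.
  have h3 : n • (y + x - y) = n • x := by
    have h4 : n • (y + x - y) = y + n • x - y := by
      rw [eq_sub_iff_add_eq]; exact h2.eq.symm
    rw [h4, hk, (period_addCommute y k).eq, add_sub_cancel_right]
  have h4 : y + x - y = x := (nsmul_right_strictMono hn).injective h3
  have h5 := congrArg val (sub_eq_iff_eq_add.1 h4)
  simpa [x, y] using h5

/-- A torsion element is determined by the number of turns its `n`-th multiple makes, which lies in
`[0, n)`. -/
theorem finite_torsion {n : ℕ} (hn : n ≠ 0) : {g : G | g ^ n = 1}.Finite := by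
  refine Set.Finite.of_injOn (f := fun g : G => (n • lift g).turn) (t := Set.Ico 0 (n : ℤ))
    ?_ ?_ (Set.finite_Ico _ _)
  · intro g hg
    have h1 : 0 ≤ n • lift g := nsmul_nonneg (lift_nonneg g) n
    have h2 : n • lift g < n • period := nsmul_right_strictMono hn (lift_lt_period g)
    obtain ⟨k, hk⟩ := exists_nsmul_eq_zsmul_period hg
    simp only [hk, nsmul_period] at h1 h2 ⊢
    simp only [zsmul_period, Set.mem_Ico] at *
    constructor
    · by_contra hh
      exact not_lt.2 h1 (Or.inl (by simpa using hh))
    · rcases h2 with h2 | h2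
      · exact h2
      · exact absurd h2.2 (not_below_one _)
  · intro g hg g' hg' e
    have : n • lift g = n • lift g' := by
      ext
      · exact e
      · simp only [nsmul_val, lift_val]; exact hg.trans hg'.symm
    exact congrArg val ((nsmul_right_strictMono hn).injective this)

end Torsion

end CyclicallyOrderedGroup

/-! ### Arcs, finite unions, and definable connectedness. -/

namespace CyclicallyOrderedGroup

open Unwound

/-- Reduces statements about the position of points on the circle to case analysis in a linear
order. -/
theorem R_iff_lift {G : Type u} [CyclicallyOrderedGroup G] {a b c : G} : R a b c ↔
    (lift a < lift b ∧ lift b < lift c) ∨ (lift b < lift c ∧ lift c < lift a) ∨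
      (lift c < lift a ∧ lift a < lift b) := by
  simp only [lift_lt_lift, R_iff_below]

theorem ne_iff_lift {G : Type u} [CyclicallyOrderedGroup G] {a b : G} :
    a ≠ b ↔ lift a < lift b ∨ lift b < lift a := by
  rw [← ne_iff_lt_or_gt, ne_eq, ne_eq]
  exact not_congr ⟨fun h => h ▸ rfl, fun h => congrArg Unwound.val h⟩

section Arcs

variable {G : Type u} [CyclicallyOrderedGroup G] {a b c d x y : G}

/-- Membership in `D` is constant on the interval `I(a, b)`. -/
def ConstOn (D : Set G) (a b : G) : Prop := ∀ x y, R a x b → R a y b → (x ∈ D ↔ y ∈ D)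

/-- Membership in `D` is constant on each interval which contains no point of `P`. -/
def ArcConst (D P : Set G) : Prop := ∀ a b, (∀ p ∈ P, ¬ R a p b) → ConstOn D a b

theorem R_mid (h : R a c b) (h' : R a x c) : R x c b ∧ R a x b := by
  (simp only [R_iff_lift] at *; grind)

theorem R_mid' (h : R a c b) (h' : R c x b) : R a c x ∧ R a x b := by
  (simp only [R_iff_lift] at *; grind)

theorem R_split (h' : R a x b) (hx : x ≠ c) : R a x c ∨ R c x b := by
  (simp only [R_iff_lift, ne_iff_lift] at *; grind)

theorem ArcConst.mono {D P Q : Set G} (h : ArcConst D P) (hPQ : P ⊆ Q) : ArcConst D Q :=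
  fun a b hab => h a b fun p hp => hab p (hPQ hp)

theorem arcConst_interval (c d : G) : ArcConst (interval c d) {c, d} := by
  intro a b hab x y hx hy
  have hc := hab c (by simp)
  have hd := hab d (by simp)
  simp only [interval, Set.mem_ofPred_eq]
  have key : ∀ x y, R a x b → R a y b → R c x d → R c y d := by
    intro x y hx hy h
    clear hab
    simp only [R_iff_lift] at *
    grind
  exact ⟨key x y hx hy, key y x hy hx⟩

/-- The breakpoints are the singletons and the endpoints of the intervals in the family. -/
theorem exists_arcConst {D : Set G} (h : IsFiniteUnion D) :
    ∃ P : Set G, P.Finite ∧ ArcConst D P := by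
  obtain ⟨F, hF, hI, rfl⟩ := h
  have : ∀ I ∈ F, ∃ P : Set G, P.Finite ∧ ArcConst I P := by
    intro I hIF
    rcases hI I hIF with ⟨g, rfl⟩ | ⟨c, d, -, rfl⟩
    · refine ⟨{g}, Set.finite_singleton g, fun a b hab x y hx hy => ?_⟩
      have := hab g rfl
      simp only [Set.mem_singleton_iff]
      constructor
      · rintro rfl; exact absurd hx this
      · rintro rfl; exact absurd hy this
    · exact ⟨{c, d}, Set.toFinite _, arcConst_interval c d⟩
  choose! P hP using this
  refine ⟨⋃ I ∈ F, P I, hF.biUnion fun I hI => (hP I hI).1, fun a b hab x y hx hy => ?_⟩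
  have : ∀ I ∈ F, (x ∈ I ↔ y ∈ I) := fun I hI =>
    (hP I hI).2 a b (fun p hp => hab p (Set.mem_biUnion hI hp)) x y hx hy
  simp only [Set.mem_sUnion]
  exact ⟨fun ⟨I, h, h'⟩ => ⟨I, h, (this I h).1 h'⟩, fun ⟨I, h, h'⟩ => ⟨I, h, (this I h).2 h'⟩⟩

/-- `D` consists of its points in `P` and of the gaps between neighbours in `P` that it contains.
Two points in `P` are needed for a gap to have distinct endpoints. -/
theorem isFiniteUnion_of_arcConst {D P : Set G} (hP : P.Finite) (h : ArcConst D P)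
    (hP2 : P.Nontrivial) : IsFiniteUnion D := by
  classical
  refine ⟨(fun g => {g}) '' (D ∩ P) ∪
    (fun q : G × G => interval q.1 q.2) '' {q | q ∈ P ×ˢ P ∧ q.1 ≠ q.2 ∧ interval q.1 q.2 ⊆ D},
    ?_, ?_, ?_⟩
  · exact ((hP.subset Set.inter_subset_right).image _).union
      (((hP.prod hP).subset fun q hq => hq.1).image _)
  · rintro I (⟨g, -, rfl⟩ | ⟨q, hq, rfl⟩)
    · exact Or.inl ⟨g, rfl⟩
    · exact Or.inr ⟨q.1, q.2, hq.2.1, rfl⟩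
  · ext x
    constructor
    · intro hx
      by_cases hxP : x ∈ P
      · exact ⟨{x}, Or.inl ⟨x, ⟨hx, hxP⟩, rfl⟩, rfl⟩
      -- the first point of `P` after `x` and the last point before `x`
      have hxp : ∀ p ∈ P, x ≠ p := fun p hp e => hxP (e ▸ hp)
      have hne : P.Nonempty := hP2.nonempty
      have first : ∃ b ∈ P, ∀ p ∈ P, ¬ R x p b := by
        have : IsStrictOrder G (fun p q => R x p q) :=
          { irrefl := fun a h => (R_ne h).2.1 rfl, trans := fun a b c h h' => R_trans h h' }
        obtain ⟨b, hb, hb'⟩ := hP.wellFoundedOn (r := fun p q => R x p q) |>.has_min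
          Set.univ ⟨⟨_, hne.choose_spec⟩, trivial⟩
        exact ⟨b, b.2, fun p hp => hb' ⟨p, hp⟩ trivial⟩
      have last : ∃ b ∈ P, ∀ p ∈ P, ¬ R x b p := by
        have : IsStrictOrder G (fun p q => R x q p) :=
          { irrefl := fun a h => (R_ne h).2.1 rfl, trans := fun a b c h h' => R_trans h' h }
        obtain ⟨b, hb, hb'⟩ := hP.wellFoundedOn (r := fun p q => R x q p) |>.has_min
          Set.univ ⟨⟨_, hne.choose_spec⟩, trivial⟩
        exact ⟨b, b.2, fun p hp => hb' ⟨p, hp⟩ trivial⟩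
      obtain ⟨b, hb, hb'⟩ := first
      obtain ⟨a, ha, ha'⟩ := last
      have hab : a ≠ b := by
        rintro rfl
        obtain ⟨p, hp, hpa⟩ := hP2.exists_ne a
        exact (R_total (hxp p hp) hpa (hxp a ha)).elim (hb' p hp) (ha' p hp)
      have hx' : R a x b :=
        R_rot (R_rot ((R_total (hxp a ha) hab (hxp b hb)).resolve_left (ha' b hb)))
      refine ⟨interval a b, Or.inr ⟨(a, b), ⟨⟨ha, hb⟩, hab, ?_⟩, rfl⟩, hx'⟩
      intro y hy
      refine (h a b ?_ x y hx' hy).1 hx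
      intro p hp hapb
      rcases R_split hapb (hxp p hp).symm with h1 | h1
      · exact ha' p hp (R_rot (R_rot h1))
      · exact hb' p hp h1
    · rintro ⟨I, ⟨g, hg, rfl⟩ | ⟨q, hq, rfl⟩, hx⟩
      · exact hx ▸ hg.1
      · exact hq.2.2 hx

variable (G) in
/-- All open intervals are nonempty. -/
def IsDense : Prop := ∀ a b : G, a ≠ b → ∃ c, R a c b

/-- A breakpoint near which `D` is constant can be discarded: density gives, on either side of `p`,
a point lying both in the arc and in the neighbourhood of `p`, and it links the values. -/
theorem ArcConst.of_insert (hG : IsDense G) {D S : Set G} {p : G} (h : ArcConst D (insert p S))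
    (hp : ∃ a b, R a p b ∧ ConstOn D a b) : ArcConst D S := by
  intro a b hab
  by_cases hapb : R a p b
  swap
  · exact h a b (by rintro q (rfl | hq); exacts [hapb, hab q hq])
  obtain ⟨u, v, hupv, huv⟩ := hp
  suffices ∀ x, R a x b → (x ∈ D ↔ p ∈ D) from
    fun x y hx hy => (this x hx).trans (this y hy).symm
  intro x hx
  by_cases hxp : x = p
  · rw [hxp]
  rcases R_split hx hxp with h1 | h1
  · obtain ⟨c, hc1, hc2⟩ : ∃ c, R a c p ∧ R u c p := by
      by_cases hau : R a u p
      · obtain ⟨c, hc⟩ := hG u p (R_ne hau).2.1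
        exact ⟨c, (R_mid' hau hc).2, hc⟩
      · obtain ⟨c, hc⟩ := hG a p (R_ne hapb).1
        clear h hab huv
        refine ⟨c, hc, ?_⟩
        simp only [R_iff_lift, ne_iff_lift] at *
        grind
    have e1 : x ∈ D ↔ c ∈ D := by
      refine h a p ?_ x c h1 hc1
      rintro q (rfl | hq) hq'
      · exact (R_ne hq').2.1 rfl
      · exact hab q hq (R_mid hapb hq').2
    exact e1.trans (huv c p (R_mid hupv hc2).2 hupv)
  · obtain ⟨c, hc1, hc2⟩ : ∃ c, R p c b ∧ R p c v := by
      by_cases hau : R p v b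
      · obtain ⟨c, hc⟩ := hG p v (R_ne hau).1
        exact ⟨c, (R_mid hau hc).2, hc⟩
      · obtain ⟨c, hc⟩ := hG p b (R_ne hapb).2.1
        clear h hab huv
        refine ⟨c, hc, ?_⟩
        simp only [R_iff_lift, ne_iff_lift] at *
        grind
    have e1 : x ∈ D ↔ c ∈ D := by
      refine h p b ?_ x c h1 hc1
      rintro q (rfl | hq) hq'
      · exact (R_ne hq').1 rfl
      · exact hab q hq (R_mid' hapb hq').2
    exact e1.trans (huv c p (R_mid' hupv hc2).2 hupv)

/-- The finitely many breakpoints outside `E` are discarded one at a time. -/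
theorem arcConst_of_locally_const (hG : IsDense G) {D : Set G} (hD : IsFiniteUnion D) (E : Set G)
    (h : ∀ p ∉ E, ∃ a b, R a p b ∧ ConstOn D a b) : ArcConst D E := by
  obtain ⟨P, hP, hDP⟩ := exists_arcConst hD
  have key : ∀ Q : Set G, Q.Finite → ArcConst D (Q ∪ E) → ArcConst D E := by
    intro Q hQ
    induction Q, hQ using Set.Finite.induction_on with
    | empty => simp
    | @insert p Q hpQ hQ ih =>
      intro hh
      rw [Set.insert_union] at hh
      apply ih
      by_cases hp : p ∈ E
      · rwa [Set.insert_eq_of_mem (show p ∈ Q ∪ E from Or.inr hp)] at hh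
      · exact hh.of_insert hG (h p hp)
  exact key P hP (hDP.mono Set.subset_union_left)

/-- A dense cyclic order is definably connected. -/
theorem mem_iff_of_locally_const (hG : IsDense G) {D : Set G} (hD : IsFiniteUnion D)
    (h : ∀ p, ∃ a b, R a p b ∧ ConstOn D a b) (x y : G) : x ∈ D ↔ y ∈ D := by
  by_cases hxy : x = y
  · rw [hxy]
  -- The cyclic order is `y, d, c, x`, so the long arc from `c` round to `d` contains both `x` and
  -- `y`.
  obtain ⟨c, hc⟩ := hG y x (Ne.symm hxy)
  obtain ⟨d, hd⟩ := hG y c (R_ne hc).1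
  refine arcConst_of_locally_const hG hD ∅ (fun p _ => h p) c d (by simp) x y ?_ ?_ <;>
  clear h <;> (simp only [R_iff_lift, ne_iff_lift] at *; grind)

/-- A dense cyclic order remains definably connected when a point is removed. -/
theorem mem_iff_of_locally_const_ne (hG : IsDense G) {D : Set G} (hD : IsFiniteUnion D) (e : G)
    (h : ∀ p ≠ e, ∃ a b, R a p b ∧ ConstOn D a b) (hx : x ≠ e) (hy : y ≠ e) : x ∈ D ↔ y ∈ D := by
  have key : ∀ x y, R e x y → (x ∈ D ↔ y ∈ D) := by
    intro x y hxy
    obtain ⟨a, ha⟩ := hG e x (R_ne hxy).1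
    obtain ⟨b, hb⟩ := hG y e (R_ne hxy).2.2
    refine arcConst_of_locally_const hG hD {e} (fun p hp => h p hp) a b ?_ x y ?_ ?_
    · rintro _ rfl
      clear h hD
      (simp only [R_iff_lift, ne_iff_lift] at *; grind)
    · clear h hD; (simp only [R_iff_lift, ne_iff_lift] at *; grind)
    · clear h hD; (simp only [R_iff_lift, ne_iff_lift] at *; grind)
  by_cases hxy : x = y
  · rw [hxy]
  rcases R_total (Ne.symm hx) hxy (Ne.symm hy) with h1 | h1
  · exact key x y h1
  · exact (key y x h1).symm

end Arcs

end CyclicallyOrderedGroup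

/-! ### The definable sets to which minimality is applied. -/

namespace CyclicallyOrderedGroup

section Formulas

open FirstOrder Language

variable {α : Type*} {G : Type u} [CyclicallyOrderedGroup G]

/-- The term `1`. -/
def oneTerm : lang.Term α := Term.func FuncSymb.one ![]

/-- The product of two terms. -/
def mulTerm (s t : lang.Term α) : lang.Term α := Term.func FuncSymb.mul ![s, t]

/-- The powers of a term. -/
def powTerm (t : lang.Term α) : ℕ → lang.Term α
  | 0 => oneTerm
  | n + 1 => mulTerm (powTerm t n) t

/-- The formula `R(s, t, u)`. -/
def cycFormula {n : ℕ} (s t u : lang.Term (α ⊕ Fin n)) : lang.BoundedFormula α n :=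
  BoundedFormula.rel RelSymb.cyc ![s, t, u]

@[simp] theorem realize_oneTerm (v : α → G) : (oneTerm : lang.Term α).realize v = 1 := rfl

@[simp] theorem realize_mulTerm (s t : lang.Term α) (v : α → G) :
    (mulTerm s t).realize v = s.realize v * t.realize v := rfl

@[simp] theorem realize_powTerm (t : lang.Term α) (n : ℕ) (v : α → G) :
    (powTerm t n).realize v = t.realize v ^ n := by
  induction n with
  | zero => simp [powTerm]
  | succ n ih => simp [powTerm, ih, pow_succ]

@[simp] theorem realize_cycFormula {n : ℕ} (s t u : lang.Term (α ⊕ Fin n)) (v : α → G)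
    (xs : Fin n → G) : (cycFormula s t u).Realize v xs ↔
      R (s.realize (Sum.elim v xs)) (t.realize (Sum.elim v xs)) (u.realize (Sum.elim v xs)) :=
  Iff.rfl

theorem IsCyclicallyMinimal.isFiniteUnion (hG : IsCyclicallyMinimal G) (φ : lang.Formula (Fin 2))
    (g : G) : IsFiniteUnion {x | φ.Realize ![x, g]} := by
  refine hG.2 _ (Set.definable_iff_exists_formula_sum.2
    ⟨φ.relabel ![Sum.inr 0, Sum.inl ⟨g, Set.mem_univ g⟩], ?_⟩)
  ext x
  simp only [Set.mem_ofPred_eq, Formula.realize_relabel]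
  have : (Sum.elim Subtype.val x ∘ ![Sum.inr 0, Sum.inl ⟨g, Set.mem_univ g⟩] : Fin 2 → G) =
      ![x 0, g] := by
    funext i
    fin_cases i <;> rfl
  rw [this]

theorem isFiniteUnion_centralizer (hG : IsCyclicallyMinimal G) (g : G) :
    IsFiniteUnion {x | x * g = g * x} := by
  have := hG.isFiniteUnion (Term.equal (mulTerm (.var 0) (.var 1)) (mulTerm (.var 1) (.var 0))) g
  simpa [Formula.realize_equal] using this

theorem isFiniteUnion_powers (hG : IsCyclicallyMinimal G) (n : ℕ) :
    IsFiniteUnion {x : G | ∃ y, y ^ n = x} := by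
  have := hG.isFiniteUnion (∃' (powTerm (.var (Sum.inr 0)) n =' .var (Sum.inl 0)) : lang.Formula (Fin 2)) 1
  simpa [Formula.Realize, Fin.snoc] using this

theorem isFiniteUnion_squares (hG : IsCyclicallyMinimal G) :
    IsFiniteUnion {x : G | ∃ y, R 1 y (y * y) ∧ y * y = x} := by
  have := hG.isFiniteUnion (∃' (cycFormula oneTerm (.var (Sum.inr 0))
    (mulTerm (.var (Sum.inr 0)) (.var (Sum.inr 0))) ⊓
    (mulTerm (.var (Sum.inr 0)) (.var (Sum.inr 0)) =' .var (Sum.inl 0))) : lang.Formula (Fin 2)) 1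
  simpa [Formula.Realize, Fin.snoc] using this

theorem isFiniteUnion_ascending (hG : IsCyclicallyMinimal G) (n : ℕ) :
    IsFiniteUnion {x : G | ∀ k < n, R 1 (x ^ (k + 1)) (x ^ (k + 2))} := by
  have : ∃ φ : lang.Formula (Fin 2), ∀ x g : G,
      φ.Realize ![x, g] ↔ ∀ k < n, R 1 (x ^ (k + 1)) (x ^ (k + 2)) := by
    induction n with
    | zero => exact ⟨⊤, by simp⟩
    | succ n ih =>
      obtain ⟨φ, hφ⟩ := ih
      refine ⟨φ ⊓ cycFormula oneTerm (powTerm (.var (Sum.inl 0)) (n + 1))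
        (powTerm (.var (Sum.inl 0)) (n + 2)), fun x g => ?_⟩
      rw [Formula.realize_inf, hφ, Nat.forall_lt_succ_right]
      simp [Formula.Realize]
  obtain ⟨φ, hφ⟩ := this
  simpa [hφ] using hG.isFiniteUnion φ 1

end Formulas

theorem IsFiniteUnion.exists_interval {G : Type u} [CyclicallyOrderedGroup G] {D : Set G}
    (hD : IsFiniteUnion D) (h : D.Infinite) :
    ∃ a b : G, (interval a b).Infinite ∧ interval a b ⊆ D := by
  obtain ⟨F, hF, hI, rfl⟩ := hD
  obtain ⟨I, hIF, hinf⟩ : ∃ I ∈ F, I.Infinite := by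
    by_contra! hn
    exact h (hF.sUnion fun I hI => by simpa using hn I hI)
  rcases hI I hIF with ⟨g, rfl⟩ | ⟨a, b, -, rfl⟩
  · exact absurd (Set.finite_singleton g) hinf
  · exact ⟨a, b, hinf, Set.subset_sUnion_of_mem hIF⟩

/-! ### Minimal groups are dense, commutative and divisible. -/

section Minimal

open Unwound

variable {G : Type u} [CyclicallyOrderedGroup G]

/-- If `y` has completed the turn, then `y - period` is a representative smaller than `x`, so its
image comes before that of `x`. -/
theorem R_one_val_iff {x y : Unwound G} (h0 : 0 < x) (hx : x < period) (hxy : x < y)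
    (hy : y < x + period) : R 1 x.val y.val ↔ y < period := by
  have ex := lift_val_eq h0.le hx
  have x1 : x.val ≠ 1 := lift_pos.1 (by rwa [ex])
  constructor
  · intro h
    by_contra hn
    set y' := y + (-1 : ℤ) • period with hy'
    have e1 : y'.val = y.val := by simp [hy']
    have e2 : y' = y - period := by rw [hy']; simp [sub_eq_add_neg]
    have h1 : 0 ≤ y' := by rw [e2]; exact sub_nonneg.2 (not_lt.1 hn)
    have h2 : y' < x := by rw [e2]; exact sub_lt_iff_lt_add.2 hy
    have h3 := lift_val_eq h1 (h2.trans hx)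
    rw [← h3, ← ex, lift_lt_lift, e1] at h2
    exact h2.asymm (Or.inr h)
  · intro h
    have ey := lift_val_eq (h0.trans hxy).le h
    rw [← ex, ← ey, lift_lt_lift, below_iff x1] at hxy
    exact hxy

theorem R_one_sq_iff {y : G} (hy : y ≠ 1) : R 1 y (y * y) ↔ lift y + lift y < period := by
  have := lift_lt_period y
  have h0 := lift_pos.2 hy
  exact R_one_val_iff (y := lift y + lift y) h0 this (lt_add_of_pos_left _ h0)
    (add_lt_add_right this _)

/-- A cyclically minimal group is densely ordered. -/
theorem IsCyclicallyMinimal.isDense (hG : IsCyclicallyMinimal G) : IsDense G := by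
  by_contra hn
  unfold IsDense at hn
  push Not at hn
  obtain ⟨a, b, hab, h⟩ := hn
  obtain ⟨s, rfl⟩ : ∃ s, b = a * s := ⟨a⁻¹ * b, by simp⟩
  have hs : s ≠ 1 := by simpa using hab
  -- A gap can be translated anywhere: every `g` has the immediate successor `g * s`, and `lift s`
  -- is the least positive element.
  have succ : ∀ g c, ¬ R g c (g * s) := by
    intro g c hc
    refine h (a * g⁻¹ * c) ?_
    simpa using R_left (a * g⁻¹) hc
  have hs0 : 0 < lift s := lift_pos.2 hs
  have least : ∀ x : Unwound G, 0 < x → lift s ≤ x := by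
    intro x hx
    by_contra! hlt
    have := lift_val_eq hx.le (hlt.trans (lift_lt_period s))
    rw [← this] at hx hlt
    have := succ 1 x.val
    rw [one_mul] at this
    exact this ((below_iff (lift_pos.1 hx)).1 (lift_lt_lift.1 hlt))
  -- Squares of elements `y` with `lift y + lift y < period` play the role of even numbers:
  -- infinitely many, no two of them consecutive.
  set D : Set G := {x : G | ∃ y, R 1 y (y * y) ∧ y * y = x} with hDdef
  have hinf : D.Infinite := by
    have hP : {y : G | R 1 y (y * y)}.Infinite := by
      intro hfin
      have : (Set.univ : Set G) ⊆ {y : G | R 1 y (y * y)} ∪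
          Inv.inv '' {y : G | R 1 y (y * y)} ∪ {y | y ^ 2 = 1} := by
        intro y _
        by_cases h2 : y * y = 1
        · exact Or.inr (by simpa [pow_two] using h2)
        left
        have h1 : (1 : G) ≠ y := by rintro rfl; simp at h2
        rcases R_total h1 (by simpa using h1.symm) (Ne.symm h2) with h3 | h3
        · exact Or.inl h3
        · refine Or.inr ⟨y⁻¹, ?_, inv_inv y⟩
          have := R_left (y⁻¹ * y⁻¹) h3
          simpa [mul_assoc] using R_rot this
      have hf := ((hfin.union (hfin.image _)).union (finite_torsion two_ne_zero)).subset this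
      exact hG.1.not_finite (Set.finite_univ_iff.1 hf)
    have : D = (fun y => y * y) '' {y : G | R 1 y (y * y)} := rfl
    rw [this]
    refine hP.image ?_
    intro y hy w hw e
    have hy' := (R_one_sq_iff (R_ne hy).1.symm).1 hy
    have hw' := (R_one_sq_iff (R_ne hw).1.symm).1 hw
    have e1 := lift_val_eq (add_nonneg (lift_nonneg y) (lift_nonneg y)) hy'
    have e2 := lift_val_eq (add_nonneg (lift_nonneg w) (lift_nonneg w)) hw'
    have e3 : lift y + lift y = lift w + lift w := by
      rw [← e1, ← e2]; exact congrArg lift e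
    rcases lt_trichotomy (lift y) (lift w) with h | h | h
    · exact absurd e3 (add_lt_add h h).ne
    · exact congrArg val h
    · exact absurd e3 (add_lt_add h h).ne'
  have sep : ∀ x ∈ D, x * s ∉ D := by
    rintro x ⟨y, hy, rfl⟩ ⟨w, hw, e⟩
    have hy' := (R_one_sq_iff (R_ne hy).1.symm).1 hy
    have hw' := (R_one_sq_iff (R_ne hw).1.symm).1 hw
    have hw0 : 0 < lift w := lift_pos.2 (R_ne hw).1.symm
    -- The distance from `lift y + lift y` to `period` is positive, hence at least `lift s`.
    -- Equality would force `w * w = 1`.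
    have h1 : lift y + lift y + lift s ≤ period := by
      refine le_neg_add_iff_add_le.1 (least _ (lt_neg_add_iff_add_lt.2 ?_))
      rwa [add_zero]
    have e2 := lift_val_eq (add_nonneg (lift_nonneg w) (lift_nonneg w)) hw'
    have e3 : (lift w + lift w).val = (lift y + lift y + lift s).val := e
    rcases h1.lt_or_eq with h1 | h1
    · have e1 := lift_val_eq (add_nonneg (add_nonneg (lift_nonneg y) (lift_nonneg y)) hs0.le) h1
      have e4 : lift w + lift w = lift y + lift y + lift s := by rw [← e1, ← e2, e3]
      rcases le_or_gt (lift w) (lift y) with h | h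
      · have := add_le_add h h
        rw [e4] at this
        exact absurd this (not_le.2 (lt_add_of_pos_right _ hs0))
      · have h5 : lift y + lift s ≤ lift w := by
          have := add_le_add_right (least (-lift y + lift w) (by simpa using h)) (lift y)
          simpa using this
        have h6 := add_le_add h5 h5
        rw [e4] at h6
        have h7 : lift y + lift y + lift s < lift y + lift s + (lift y + lift s) := by
          rw [add_assoc, add_assoc (lift y) (lift s)]
          exact add_lt_add_right (lt_add_of_pos_left _ hs0) _
        exact absurd h6 (not_le.2 h7)
    · rw [h1] at e3
      have := lift_pos.1 (e2.symm ▸ add_pos hw0 hw0 : 0 < lift (lift w + lift w).val)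
      exact this e3
  obtain ⟨a, b, hI, hID⟩ := (isFiniteUnion_squares hG).exists_interval hinf
  -- An interval inside `D` cannot contain a point together with its successor, so it has at most
  -- one point.
  have key : ∀ x, R a x b → x * s = b := by
    intro x hx
    by_contra hne
    have h1 : R x (x * s) b := by
      refine (R_total ?_ hne (R_ne hx).2.1).resolve_right (succ x b)
      simpa [eq_comm] using hs
    exact sep x (hID hx) (hID (R_mid' hx h1).2)
  obtain ⟨x, hx, y, hy, hxy⟩ := hI.nontrivial
  exact hxy (mul_right_cancel ((key x hx).trans (key y hy).symm))

/-- `H` contains an interval; its right translates show that the cosets are open, so membership in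
`H` is locally constant and connectedness applies. -/
theorem IsCyclicallyMinimal.mem_subgroup (hG : IsCyclicallyMinimal G) (H : Subgroup G)
    (hH : IsFiniteUnion (H : Set G)) (hinf : (H : Set G).Infinite) (x : G) : x ∈ H := by
  obtain ⟨a, b, hI, hIH⟩ := hH.exists_interval hinf
  obtain ⟨h, hh⟩ := hI.nonempty
  refine (mem_iff_of_locally_const hG.isDense hH (fun p => ?_) 1 x).1 H.one_mem
  refine ⟨a * (h⁻¹ * p), b * (h⁻¹ * p), by simpa using R_right (h⁻¹ * p) hh, ?_⟩
  have key : ∀ x, R (a * (h⁻¹ * p)) x (b * (h⁻¹ * p)) → (x ∈ H ↔ p ∈ H) := by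
    intro x hx
    have h1 : x * (p⁻¹ * h) ∈ H := hIH (by simpa [interval, mul_assoc] using R_right (p⁻¹ * h) hx)
    have h2 : x * p⁻¹ ∈ H := by simpa [mul_assoc] using H.mul_mem h1 (H.inv_mem (hIH hh))
    constructor
    · intro h3; simpa using H.mul_mem (H.inv_mem h2) h3
    · intro h3; simpa using H.mul_mem h2 h3
  exact fun x y hx hy => (key x hx).trans (key y hy).symm

/-- An element of infinite order has an infinite centralizer, since it contains the powers; torsion
is central anyway. -/
theorem IsCyclicallyMinimal.mul_comm (hG : IsCyclicallyMinimal G) (a g : G) :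
    a * g = g * a := by
  by_cases hg : IsOfFinOrder g
  · obtain ⟨n, hn, h⟩ := isOfFinOrder_iff_pow_eq_one.1 hg
    exact torsion_central hn.ne' h a
  · have e : (Subgroup.centralizer {g} : Set G) = {x | x * g = g * x} := by
      ext x; simp [Subgroup.mem_centralizer_singleton_iff]
    have := hG.mem_subgroup (Subgroup.centralizer {g}) (e ▸ isFiniteUnion_centralizer hG g) ?_ a
    · exact Subgroup.mem_centralizer_singleton_iff.1 this
    · refine Set.Infinite.mono ?_ (infinite_zpowers.2 hg)
      rintro _ ⟨n, rfl⟩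
      rw [e]
      exact ((Commute.refl g).zpow_left n).eq

/-- The power map has finite fibres because torsion is finite, so its image is an infinite definable
subgroup. -/
theorem IsCyclicallyMinimal.exists_pow_eq (hG : IsCyclicallyMinimal G) {n : ℕ} (hn : n ≠ 0)
    (x : G) : ∃ y, y ^ n = x := by
  let H : Subgroup G :=
    { carrier := {x | ∃ y, y ^ n = x}
      mul_mem' := by
        rintro _ _ ⟨a, rfl⟩ ⟨b, rfl⟩
        exact ⟨a * b, Commute.mul_pow (hG.mul_comm a b) n⟩
      one_mem' := ⟨1, one_pow n⟩
      inv_mem' := by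
        rintro _ ⟨a, rfl⟩
        exact ⟨a⁻¹, inv_pow a n⟩ }
  refine hG.mem_subgroup H (isFiniteUnion_powers hG n) ?_ x
  intro hfin
  have : (Set.univ : Set G).Finite := by
    refine Set.Finite.of_finite_fibers (fun y => y ^ n) ?_ ?_
    · refine hfin.subset ?_
      rintro _ ⟨y, -, rfl⟩
      exact ⟨y, rfl⟩
    · rintro _ ⟨y, -, rfl⟩
      refine ((finite_torsion hn).image (fun t => t * y)).subset ?_
      rintro w ⟨-, hw⟩
      refine ⟨w * y⁻¹, ?_, by simp⟩
      have hw : w ^ n = y ^ n := hw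
      change (w * y⁻¹) ^ n = 1
      rw [Commute.mul_pow (hG.mul_comm w y⁻¹), hw, inv_pow, mul_inv_cancel]
  exact hG.1.not_finite (Set.finite_univ_iff.1 this)

end Minimal

end CyclicallyOrderedGroup

/-! ### Existence of torsion in minimal groups. -/

namespace CyclicallyOrderedGroup

/-- Plays the role of continuity of `x ↦ n • x`: small changes of `x` keep `n • x` on the same side
of `period`. -/
theorem exists_nsmul_lt {M : Type*} [AddCommGroup M] [LinearOrder M] [IsOrderedAddMonoid M]
    (hM : ∀ x : M, 0 < x → ∃ y, 0 < y ∧ y < x) {x : M} (hx : 0 < x) (n : ℕ) :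
    ∃ e, 0 < e ∧ n • e < x := by
  induction n with
  | zero => obtain ⟨y, hy, -⟩ := hM x hx; exact ⟨y, hy, by simpa using hx⟩
  | succ n ih =>
    obtain ⟨e, he, h⟩ := ih
    obtain ⟨d, hd, hlt⟩ := hM (min e (x - n • e)) (lt_min he (sub_pos.2 h))
    refine ⟨d, hd, ?_⟩
    rw [succ_nsmul]
    calc n • d + d ≤ n • e + d := by
          gcongr; exact (hlt.trans_le (min_le_left _ _)).le
      _ < n • e + (x - n • e) := by
          gcongr; exact hlt.trans_le (min_le_right _ _)
      _ = x := by abel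

/-- The first-order properties which characterize cyclically minimal groups: the group is
commutative, divisible, and has elements of each prime order. -/
structure IsDivisibleWithTorsion (G : Type u) [CyclicallyOrderedGroup G] : Prop where
  mul_comm : ∀ a b : G, a * b = b * a
  exists_pow_eq : ∀ p : ℕ, p.Prime → ∀ x : G, ∃ y, y ^ p = x
  exists_torsion : ∀ p : ℕ, p.Prime → ∃ x : G, x ≠ 1 ∧ x ^ p = 1

section

open Unwound

variable {G : Type u} [CyclicallyOrderedGroup G]

theorem IsDense.exists_pos_lt [Nontrivial G] (hG : IsDense G) {x : Unwound G} (hx : 0 < x) :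
    ∃ y, 0 < y ∧ y < x := by
  rcases le_or_gt period x with h | h
  · obtain ⟨g, hg⟩ := exists_ne (1 : G)
    exact ⟨lift g, lift_pos.2 hg, (lift_lt_period g).trans_le h⟩
  · have e := lift_val_eq hx.le h
    have h1 : x.val ≠ 1 := lift_pos.1 (e.symm ▸ hx)
    obtain ⟨c, hc⟩ := hG 1 x.val h1.symm
    refine ⟨lift c, lift_pos.2 (R_ne hc).1.symm, ?_⟩
    rw [← e]
    exact lift_lt_lift.2 (Or.inr hc)

/-- Each link of the chain says that one more multiple of `lift x` stays short of a full turn. It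
makes the right-hand side definable in `G`. -/
theorem ascending_iff {x : G} (hx : x ≠ 1) (n : ℕ) :
    (∀ k < n, R 1 (x ^ (k + 1)) (x ^ (k + 2))) ↔ (n + 1) • lift x < period := by
  have hpos := lift_pos.2 hx
  induction n with
  | zero => simp [lift_lt_period]
  | succ n ih =>
    refine Nat.forall_lt_succ_right.trans ((and_congr_left' ih).trans ?_)
    have h1 : 0 < (n + 1) • lift x := nsmul_pos hpos n.succ_ne_zero
    have h2 : (n + 1 + 1) • lift x = (n + 1) • lift x + lift x := succ_nsmul _ _
    have h3 : (n + 1) • lift x < (n + 1 + 1) • lift x := by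
      rw [h2]; exact lt_add_of_pos_right _ hpos
    have key : (n + 1) • lift x < period →
        (R 1 (x ^ (n + 1)) (x ^ (n + 2)) ↔ (n + 1 + 1) • lift x < period) := by
      intro h
      have := R_one_val_iff h1 h h3 (by rw [h2]; exact add_lt_add_right (lift_lt_period x) _)
      simpa only [nsmul_val, lift_val] using this
    constructor
    · rintro ⟨h, h'⟩
      exact (key h).1 h'
    · intro h
      exact ⟨h3.trans h, (key (h3.trans h)).2 h⟩

/-- Without `n`-torsion, `n • lift x` never equals `period`, so the side on which it lies is locally
constant away from `1`, hence constant. Small `e` fall below; then so does `period - e`, and adding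
gives `n • period < 2 • period`. -/
theorem IsCyclicallyMinimal.exists_torsion (hG : IsCyclicallyMinimal G) {n : ℕ} (hn : 2 ≤ n) :
    ∃ x : G, x ≠ 1 ∧ x ^ n = 1 := by
  have hinf := hG.1
  obtain ⟨m, rfl⟩ : ∃ m, n = m + 1 := ⟨n - 1, by omega⟩
  let _ : AddCommGroup (Unwound G) := addCommGroup hG.mul_comm
  have : IsOrderedAddMonoid (Unwound G) := { add_le_add_left := fun a b h c => by gcongr }
  have hd : ∀ x : Unwound G, 0 < x → ∃ y, 0 < y ∧ y < x := fun x hx => hG.isDense.exists_pos_lt hx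
  by_contra! hno
  set D := {x : G | ∀ k < m, R 1 (x ^ (k + 1)) (x ^ (k + 2))} with hD
  have mem : ∀ {x : G}, x ≠ 1 → (x ∈ D ↔ (m + 1) • lift x < period) := fun hx =>
    ascending_iff hx m
  have mono : ∀ {x y : Unwound G}, x < y → (m + 1) • x < (m + 1) • y := fun h =>
    nsmul_right_strictMono m.succ_ne_zero h
  have le_smul : ∀ {x : Unwound G}, 0 ≤ x → x ≤ (m + 1) • x := fun h => by
    rw [succ_nsmul]; exact le_add_of_nonneg_left (nsmul_nonneg h m)
  have const : ∀ {x y : G}, x ≠ 1 → y ≠ 1 → (x ∈ D ↔ y ∈ D) := by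
    intro x y hx hy
    refine mem_iff_of_locally_const_ne hG.isDense (isFiniteUnion_ascending hG m) 1 ?_ hx hy
    intro p hp
    have hp0 := lift_pos.2 hp
    rcases lt_trichotomy ((m + 1) • lift p) period with h | h | h
    · obtain ⟨e, he, hlt⟩ := exists_nsmul_lt hd (sub_pos.2 h) (m + 1)
      have h1 : (m + 1) • (lift p + e) < period := by
        rw [smul_add]; exact lt_sub_iff_add_lt'.1 hlt
      have h2 : lift p + e < period :=
        (le_smul (add_pos hp0 he).le).trans_lt h1
      have e1 := lift_val_eq (add_pos hp0 he).le h2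
      refine ⟨1, (lift p + e).val, ?_, ?_⟩
      · rw [← below_iff hp, ← lift_lt_lift, e1]
        exact lt_add_of_pos_right _ he
      · have key : ∀ z, R 1 z (lift p + e).val → z ∈ D := by
          intro z hz
          have hz1 := (R_ne hz).1.symm
          rw [← below_iff hz1, ← lift_lt_lift, e1] at hz
          exact (mem hz1).2 ((mono hz).trans h1)
        exact fun x y hx hy => iff_of_true (key x hx) (key y hy)
    · refine absurd ?_ (hno p hp)
      have := congrArg val h
      simpa using this
    · obtain ⟨e, he, hlt⟩ := exists_nsmul_lt hd (sub_pos.2 h) (m + 1)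
      have h1 : period < (m + 1) • (lift p - e) := by
        rw [smul_sub]; exact lt_sub_comm.1 hlt
      have h0 : 0 < lift p - e := by
        by_contra! hn
        exact absurd (h1.trans_le (nsmul_nonpos hn _)) (not_lt.2 period_pos.le)
      have h2 : lift p - e < lift p := sub_lt_self _ he
      have e1 := lift_val_eq h0.le (h2.trans (lift_lt_period p))
      have hne : (lift p - e).val ≠ 1 := lift_pos.1 (e1.symm ▸ h0)
      refine ⟨(lift p - e).val, 1, ?_, ?_⟩
      · refine R_rot ?_
        rw [← below_iff hne, ← lift_lt_lift, e1]
        exact h2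
      · have key : ∀ z, R (lift p - e).val z 1 → z ∉ D := by
          intro z hz
          have hz1 := (R_ne hz).2.1
          have hz' := R_rot (R_rot hz)
          rw [← below_iff hne, ← lift_lt_lift, e1] at hz'
          rw [mem hz1]
          exact not_lt.2 (h1.trans (mono hz')).le
        exact fun x y hx hy => iff_of_false (key x hx) (key y hy)
  obtain ⟨e, he, hlt⟩ := exists_nsmul_lt hd period_pos (m + 1)
  have e1 := lift_val_eq he.le ((le_smul he.le).trans_lt hlt)
  have hne : e.val ≠ 1 := lift_pos.1 (e1.symm ▸ he)
  have h1 : ∀ x : Unwound G, 0 < x → x < period → (m + 1) • x < period := by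
    intro x h0 hx
    have e2 := lift_val_eq h0.le hx
    have hne' : x.val ≠ 1 := lift_pos.1 (e2.symm ▸ h0)
    rw [← e2, ← mem hne', const hne' hne, mem hne, e1]
    exact hlt
  have he' := (le_smul he.le).trans_lt hlt
  have h2 := h1 _ (sub_pos.2 he') (sub_lt_self _ he)
  have h3 : period + period < period + period :=
    calc period + period ≤ (m + 1) • (period : Unwound G) := by
          rw [← two_nsmul]; exact nsmul_le_nsmul_left period_pos.le hn
      _ = (m + 1) • e + (m + 1) • (period - e) := by rw [← smul_add, add_sub_cancel]
      _ < period + period := add_lt_add hlt h2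
  exact lt_irrefl _ h3

theorem IsCyclicallyMinimal.isDivisibleWithTorsion (hG : IsCyclicallyMinimal G) :
    IsDivisibleWithTorsion G where
  mul_comm := hG.mul_comm
  exists_pow_eq _ hp := hG.exists_pow_eq hp.ne_zero
  exists_torsion _ hp := hG.exists_torsion hp.two_le

end

end CyclicallyOrderedGroup

/-! ### Sign patterns of affine functions over a divisible ordered group. -/

namespace CyclicallyOrderedGroup

section SameSign

variable {M : Type*} [AddCommGroup M] [LinearOrder M]

/-- `a` and `b` have the same sign. -/
def SameSign (a b : M) : Prop := cmp a 0 = cmp b 0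

theorem SameSign.symm {a b : M} (h : SameSign a b) : SameSign b a := Eq.symm h

theorem SameSign.neg_iff {a b : M} (h : SameSign a b) : a < 0 ↔ b < 0 := by
  rw [← cmp_eq_lt_iff, ← cmp_eq_lt_iff, show cmp a 0 = cmp b 0 from h]

theorem SameSign.zero_iff {a b : M} (h : SameSign a b) : a = 0 ↔ b = 0 := by
  rw [← cmp_eq_eq_iff a, ← cmp_eq_eq_iff b, show cmp a 0 = cmp b 0 from h]

theorem SameSign.nonneg_iff {a b : M} (h : SameSign a b) : 0 ≤ a ↔ 0 ≤ b := by
  rw [← not_lt, ← not_lt, h.neg_iff]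

variable [IsOrderedAddMonoid M]

theorem sameSign_sub_iff {a b c d : M} : SameSign (a - b) (c - d) ↔ cmp a b = cmp c d := by
  rw [SameSign, cmp_sub_zero, cmp_sub_zero]

theorem cmp_zsmul_zero {k : ℤ} (hk : 0 < k) (a : M) : cmp (k • a) 0 = cmp a 0 := by
  rcases lt_trichotomy a 0 with h | h | h
  · have : k • a < 0 := by simpa using zsmul_lt_zsmul_right hk h
    rw [cmp_eq_lt_iff _ _ |>.2 h, cmp_eq_lt_iff _ _ |>.2 this]
  · simp [h]
  · rw [cmp_eq_gt_iff _ _ |>.2 h, cmp_eq_gt_iff _ _ |>.2 (zsmul_pos h hk)]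

theorem sameSign_zsmul {k : ℤ} (hk : k ≠ 0) {a b : M} :
    SameSign (k • a) (k • b) ↔ SameSign a b := by
  rcases lt_or_gt_of_ne hk with h | h
  · have e : ∀ x : M, k • x = (-k) • (0 - x) := by intro x; simp
    have h' : 0 < -k := by omega
    rw [e, e, SameSign, cmp_zsmul_zero h', cmp_zsmul_zero h']
    change SameSign _ _ ↔ _
    rw [sameSign_sub_iff, cmp_eq_cmp_symm]
    rfl
  · rw [SameSign, cmp_zsmul_zero h, cmp_zsmul_zero h]
    rfl

/-- Finitely many affine functions of one variable over a divisible ordered group: a value of the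
variable can be matched when the coefficients have the same relative signs. -/
theorem exists_sameSign_matching [DenselyOrdered M] [Nontrivial M]
    (hdiv : ∀ k : ℤ, k ≠ 0 → ∀ x : M, ∃ y, k • y = x)
    {J : Type*} (s : Finset J) (k : J → ℤ) (g g' : J → M)
    (h0 : ∀ j ∈ s, SameSign (g j) (g' j))
    (h1 : ∀ i ∈ s, ∀ j ∈ s, SameSign (k i • g j - k j • g i) (k i • g' j - k j • g' i)) (y : M) :
    ∃ y', ∀ j ∈ s, SameSign (g j + k j • y) (g' j + k j • y') := by
  classical
  choose! r hr using fun (j : J) (hj : k j ≠ 0) => hdiv (k j) hj (-g j)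
  choose! r' hr' using fun (j : J) (hj : k j ≠ 0) => hdiv (k j) hj (-g' j)
  -- The roots of the functions are matched with the roots of their primed versions. Comparing `r i`
  -- with `r j` amounts, up to the factor `k i * k j`, to the sign of a cross difference, so `h1`
  -- says that this is a partial isomorphism; back-and-forth then places `y'`.
  let f : Order.PartialIso M M :=
    ⟨(s.filter fun j => k j ≠ 0).image fun j => (r j, r' j), by
      intro p hp q hq
      simp only [Finset.mem_image, Finset.mem_filter] at hp hq
      obtain ⟨i, ⟨hi, hki⟩, rfl⟩ := hp
      obtain ⟨j, ⟨hj, hkj⟩, rfl⟩ := hq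
      rw [← sameSign_sub_iff, ← sameSign_zsmul (mul_ne_zero hki hkj)]
      have e : ∀ a b c d : M, k i • a = -c → k j • b = -d →
          (k i * k j) • (a - b) = k i • d - k j • c := by
        intro a b c d ha hb
        rw [smul_sub, mul_smul (k i) (k j) b, hb, mul_comm, mul_smul, ha]
        simp only [smul_neg]
        abel
      rw [e _ _ _ _ (hr i hki) (hr j hkj), e _ _ _ _ (hr' i hki) (hr' j hkj)]
      exact h1 i hi j hj⟩
  obtain ⟨y', hy'⟩ := f.exists_across y
  refine ⟨y', fun j hj => ?_⟩
  by_cases hk : k j = 0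
  · simpa [hk] using h0 j hj
  have h2 := hy' (r j, r' j)
    (Finset.mem_image_of_mem _ (Finset.mem_filter.2 ⟨hj, hk⟩))
  have e : ∀ a b c : M, k j • a = -c → c + k j • b = k j • (b - a) := by
    intro a b c ha
    rw [smul_sub, ha]; abel
  rw [e _ _ _ (hr j hk), e _ _ _ (hr' j hk), sameSign_zsmul hk, sameSign_sub_iff, cmp_eq_cmp_symm]
  exact h2

end SameSign

section Affine

variable (M : Type*) [AddCommGroup M] (ι : Type*)

/-- The affine functions with integral linear part. -/
def affine : AddSubgroup ((ι → M) → M) :=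
  AddSubgroup.closure (Set.range (fun i X => X i) ∪ Set.range (fun c _ => c))

variable {M ι}

theorem coord_mem_affine (i : ι) : (fun X : ι → M => X i) ∈ affine M ι :=
  AddSubgroup.subset_closure (Or.inl ⟨i, rfl⟩)

theorem const_mem_affine (c : M) : (fun _ : ι → M => c) ∈ affine M ι :=
  AddSubgroup.subset_closure (Or.inr ⟨c, rfl⟩)

/-- Isolates the variable `y` to be eliminated, with an integer coefficient. -/
theorem affine_comp {κ : Type*} (L : (κ → M) → M → ι → M)
    (hL : ∀ i, ∃ g ∈ affine M κ, ∃ k : ℤ, ∀ X y, L X y i = g X + k • y)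
    {f : (ι → M) → M} (hf : f ∈ affine M ι) :
    ∃ g ∈ affine M κ, ∃ k : ℤ, ∀ X y, f (L X y) = g X + k • y := by
  induction hf using AddSubgroup.closure_induction with
  | mem f hf =>
    rcases hf with ⟨i, rfl⟩ | ⟨c, rfl⟩
    · exact hL i
    · exact ⟨_, const_mem_affine c, 0, by simp⟩
  | zero => exact ⟨0, zero_mem _, 0, by simp⟩
  | add f₁ f₂ _ _ h₁ h₂ =>
    obtain ⟨g₁, hg₁, k₁, e₁⟩ := h₁
    obtain ⟨g₂, hg₂, k₂, e₂⟩ := h₂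
    refine ⟨g₁ + g₂, add_mem hg₁ hg₂, k₁ + k₂, fun X y => ?_⟩
    simp only [Pi.add_apply, e₁, e₂, add_smul]
    abel
  | neg f _ h =>
    obtain ⟨g, hg, k, e⟩ := h
    refine ⟨-g, neg_mem hg, -k, fun X y => ?_⟩
    simp only [Pi.neg_apply, e, neg_smul]
    abel

end Affine

/-! ### Divisibility and density of the unwound. -/

section Divisible

open Unwound

variable {G : Type u} [CyclicallyOrderedGroup G]

/-- The unwound of a commutative divisible group with torsion is divisible. -/
theorem IsDivisibleWithTorsion.exists_nsmul_eq (hG : IsDivisibleWithTorsion G) (n : ℕ) :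
    n ≠ 0 → ∀ x : Unwound G, ∃ y, n • y = x := by
  let _ : AddCommGroup (Unwound G) := addCommGroup hG.mul_comm
  have : IsOrderedAddMonoid (Unwound G) := { add_le_add_left := fun a b h c => by gcongr }
  induction n using induction_on_primes with
  | zero => exact fun h => absurd rfl h
  | one => exact fun _ x => ⟨x, one_smul _ x⟩
  | prime_mul p n hp ih =>
    intro hpn x
    obtain ⟨w, hw1, hw⟩ := hG.exists_torsion p hp
    obtain ⟨k, hk⟩ := exists_nsmul_eq_zsmul_period hw
    have hk0 : 0 < k := by
      by_contra! hn
      have h1 : 0 < k • (period : Unwound G) := hk ▸ nsmul_pos (lift_pos.2 hw1) hp.ne_zero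
      have h2 := zsmul_le_zsmul_left (period_pos (G := G)).le hn
      rw [zero_smul] at h2
      exact absurd h1 (not_lt.2 h2)
    have hkp : k < p := by
      by_contra! hn
      have h1 : k • (period : Unwound G) < p • period :=
        hk ▸ nsmul_right_strictMono hp.ne_zero (lift_lt_period w)
      have h2 := zsmul_le_zsmul_left (period_pos (G := G)).le hn
      rw [natCast_zsmul] at h2
      exact absurd h1 (not_lt.2 h2)
    have hcop : IsCoprime k (p : ℤ) := by
      rw [Int.isCoprime_iff_gcd_eq_one, Int.gcd_comm]
      have hnd : ¬ p ∣ k.natAbs := fun hd => by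
        have := Nat.le_of_dvd (by omega) hd
        omega
      simpa [Int.gcd] using (Nat.Prime.coprime_iff_not_dvd hp).2 hnd
    -- Here `p • lift w = k • period` with `0 < k < p`. Bézout turns this into `U` with `p • U =
    -- period`, which absorbs the turns left over when a `p`-th root is taken in `G`.
    obtain ⟨a, b, hab⟩ := hcop
    set U : Unwound G := a • lift w + b • period with hU
    have hpU : p • U = period := by
      rw [hU, smul_add, smul_comm p a, hk, ← mul_smul, smul_comm p b, ← natCast_zsmul, ← mul_smul,
        ← add_smul, hab, one_smul]
    obtain ⟨g, hg⟩ := hG.exists_pow_eq p hp x.val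
    obtain ⟨i, hi⟩ := (val_eq_iff (x := x) (y := p • lift g)).1 (by simp [hg])
    have hx : x = p • (lift g + i • U) := by
      rw [smul_add, smul_comm p i, hpU, ← hi]
    obtain ⟨y, hy⟩ := ih (by rintro rfl; simp at hpn) (lift g + i • U)
    exact ⟨y, by rw [mul_smul, hy, ← hx]⟩

theorem IsDivisibleWithTorsion.exists_zsmul_eq (hG : IsDivisibleWithTorsion G) (k : ℤ) (hk : k ≠ 0)
    (x : Unwound G) : ∃ y, k • y = x := by
  obtain ⟨n, rfl | rfl⟩ := k.eq_nat_or_neg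
  · obtain ⟨y, hy⟩ := hG.exists_nsmul_eq n (by simpa using hk) x
    exact ⟨y, by simpa using hy⟩
  · obtain ⟨y, hy⟩ := hG.exists_nsmul_eq n (by simpa using hk) (-x)
    exact ⟨y, by simp [hy]⟩

theorem IsDivisibleWithTorsion.denselyOrdered (hG : IsDivisibleWithTorsion G) :
    DenselyOrdered (Unwound G) := by
  let _ : AddCommGroup (Unwound G) := addCommGroup hG.mul_comm
  have : IsOrderedAddMonoid (Unwound G) := { add_le_add_left := fun a b h c => by gcongr }
  refine ⟨fun a b h => ?_⟩
  obtain ⟨c, hc⟩ := hG.exists_nsmul_eq 2 two_ne_zero (a + b)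
  rw [two_nsmul] at hc
  refine ⟨c, ?_, ?_⟩
  · by_contra! hn
    have := add_le_add hn hn
    rw [hc] at this
    exact absurd h (not_lt.2 (le_of_add_le_add_left this))
  · by_contra! hn
    have := add_le_add hn hn
    rw [hc] at this
    exact absurd h (not_lt.2 (le_of_add_le_add_right this))

theorem IsDivisibleWithTorsion.infinite (hG : IsDivisibleWithTorsion G) : Infinite G := by
  have : Nontrivial (Unwound G) := ⟨0, period, period_pos.ne⟩
  have := hG.denselyOrdered
  have := (Set.Ico_infinite (period_pos (G := G))).image (f := val) (by
    intro x hx y hy e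
    rw [← lift_val_eq hx.1 hx.2, ← lift_val_eq hy.1 hy.2]
    exact congrArg lift e)
  exact Set.infinite_univ_iff.1 (this.mono (Set.subset_univ _))

end Divisible

end CyclicallyOrderedGroup

/-! ### Quantifier elimination. -/

namespace CyclicallyOrderedGroup

open Unwound FirstOrder Language

section Elimination

variable {G : Type u} [CyclicallyOrderedGroup G]

/-- All coordinates of `X` lie in `[0, period)`. -/
def InBox {ι : Type*} (X : ι → Unwound G) : Prop := ∀ i, 0 ≤ X i ∧ X i < period

/-- The uniform bound by `K` turns on the box leaves only finitely many turn counts to consider,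
hence finitely many sign conditions per atomic formula. -/
theorem exists_affine_lift (hG : ∀ a b : G, a * b = b * a) :
    letI : AddCommGroup (Unwound G) := addCommGroup hG
    ∀ {ι : Type*} (t : lang.Term ι), ∃ f ∈ affine (Unwound G) ι, ∃ K : ℕ, ∀ X, InBox X →
      (f X).val = t.realize (fun i => (X i).val) ∧
        -(K • period) ≤ f X ∧ f X ≤ K • period := by
  intro ι t
  let _ : AddCommGroup (Unwound G) := addCommGroup hG
  have : IsOrderedAddMonoid (Unwound G) := { add_le_add_left := fun a b h c => by gcongr }
  induction t with
  | var i =>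
    refine ⟨_, coord_mem_affine i, 1, fun X hX => ⟨rfl, ?_, ?_⟩⟩
    · have h1 : -(1 • (period : Unwound G)) ≤ 0 := by simpa using period_pos.le
      exact h1.trans (hX i).1
    · simpa using (hX i).2.le
  | func s ts ih =>
    cases s with
    | one => exact ⟨0, zero_mem _, 0, fun X _ => by simp; rfl⟩
    | inv =>
      obtain ⟨f, hf, K, h⟩ := ih 0
      refine ⟨-f, neg_mem hf, K, fun X hX => ⟨?_, ?_, ?_⟩⟩
      · change (f X).val⁻¹ = _
        rw [(h X hX).1]
        rfl
      · exact neg_le_neg (h X hX).2.2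
      · exact neg_le.1 (h X hX).2.1
    | mul =>
      obtain ⟨f, hf, K, h⟩ := ih 0
      obtain ⟨f', hf', K', h'⟩ := ih 1
      refine ⟨f + f', add_mem hf hf', K + K', fun X hX => ⟨?_, ?_, ?_⟩⟩
      · change (f X).val * (f' X).val = _
        rw [(h X hX).1, (h' X hX).1]
        rfl
      · rw [add_smul, neg_add]
        exact add_le_add (h X hX).2.1 (h' X hX).2.1
      · rw [add_smul]
        exact add_le_add (h X hX).2.2 (h' X hX).2.2

theorem abs_le_of_zsmul_period_lt (hG : ∀ a b : G, a * b = b * a) {i : ℤ} {n : ℕ}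
    (h : i • (period : Unwound G) ≤ n • period) (h' : -(n • (period : Unwound G)) ≤ i • period) :
    i ∈ Finset.Icc (-n : ℤ) n := by
  let _ : AddCommGroup (Unwound G) := addCommGroup hG
  have : IsOrderedAddMonoid (Unwound G) := { add_le_add_left := fun a b h c => by gcongr }
  rw [← natCast_zsmul] at h h'
  rw [← neg_smul] at h'
  rw [Finset.mem_Icc]
  exact ⟨(zsmul_le_zsmul_iff_left period_pos).1 h', (zsmul_le_zsmul_iff_left period_pos).1 h⟩

/-- Quantifier elimination: on points with coordinates in `[0, period)`, the truth of a formula is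
determined by the signs of finitely many affine functions. -/
theorem IsDivisibleWithTorsion.exists_sign_determined (hG : IsDivisibleWithTorsion G) :
    letI : AddCommGroup (Unwound G) := addCommGroup hG.mul_comm
    ∀ {α : Type*} {n : ℕ} (φ : lang.BoundedFormula α n),
      ∃ F : Finset ((α ⊕ Fin n → Unwound G) → Unwound G), (∀ f ∈ F, f ∈ affine _ _) ∧
        ∀ (v v' : α → Unwound G) (x x' : Fin n → Unwound G),
          InBox v → InBox v' → InBox x → InBox x' →
          (∀ f ∈ F, SameSign (f (Sum.elim v x)) (f (Sum.elim v' x'))) →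
          φ.Realize (fun i => (v i).val) (fun i => (x i).val) →
          φ.Realize (fun i => (v' i).val) (fun i => (x' i).val) := by
  classical
  intro α n φ
  let _ : AddCommGroup (Unwound G) := addCommGroup hG.mul_comm
  have : IsOrderedAddMonoid (Unwound G) := { add_le_add_left := fun a b h c => by gcongr }
  have box : ∀ {n} {v : α → Unwound G} {x : Fin n → Unwound G}, InBox v → InBox x →
      InBox (Sum.elim v x) := by
    rintro n v x hv hx (i | i)
    exacts [hv i, hx i]
  have elim : ∀ {n} (v : α → Unwound G) (x : Fin n → Unwound G),
      (fun i => (Sum.elim v x i).val) = Sum.elim (fun i => (v i).val) (fun i => (x i).val) := by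
    intro n v x
    funext i
    cases i <;> rfl
  induction φ with
  | falsum => exact ⟨∅, by simp, fun v v' x x' _ _ _ _ _ h => h⟩
  | equal t₁ t₂ =>
    obtain ⟨f₁, hf₁, K₁, h₁⟩ := exists_affine_lift hG.mul_comm t₁
    obtain ⟨f₂, hf₂, K₂, h₂⟩ := exists_affine_lift hG.mul_comm t₂
    -- Equality in `G` means that `f₁ - f₂` is `i • period` for some `i`; the bounds leave only
    -- these `i`.
    refine ⟨(Finset.Icc (-(K₁ + K₂ : ℕ) : ℤ) (K₁ + K₂ : ℕ)).image
      (fun i : ℤ => f₁ - f₂ - fun _ => i • period), ?_, ?_⟩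
    · intro f hf
      obtain ⟨i, -, rfl⟩ := Finset.mem_image.1 hf
      exact sub_mem (sub_mem hf₁ hf₂) (const_mem_affine _)
    · intro v v' x x' hv hv' hx hx' hs h
      have e₁ := h₁ _ (box hv hx)
      have e₂ := h₂ _ (box hv hx)
      have e₁' := h₁ _ (box hv' hx')
      have e₂' := h₂ _ (box hv' hx')
      rw [elim] at e₁ e₂ e₁' e₂'
      have h : t₁.realize _ = t₂.realize _ := h
      change t₁.realize _ = t₂.realize _
      rw [← e₁.1, ← e₂.1, val_eq_iff] at h
      obtain ⟨i, hi⟩ := h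
      have hi' : i • period = f₁ (Sum.elim v x) - f₂ (Sum.elim v x) := by rw [hi]; abel
      have hmem : i ∈ Finset.Icc (-(K₁ + K₂ : ℕ) : ℤ) (K₁ + K₂ : ℕ) := by
        apply abs_le_of_zsmul_period_lt hG.mul_comm
        · rw [hi', add_smul, sub_eq_add_neg]
          exact add_le_add e₁.2.2 (neg_le.1 e₂.2.1)
        · rw [hi', add_smul, sub_eq_add_neg, neg_add]
          exact add_le_add e₁.2.1 (neg_le_neg e₂.2.2)
      have := (hs _ (Finset.mem_image_of_mem _ hmem)).zero_iff
      simp only [Pi.sub_apply] at this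
      rw [← hi', sub_self, eq_self, true_iff] at this
      rw [← e₁'.1, ← e₂'.1, val_eq_iff]
      refine ⟨i, ?_⟩
      rw [sub_sub, sub_eq_zero] at this
      exact this
  | rel r ts =>
    cases r
    obtain ⟨f₁, hf₁, K₁, h₁⟩ := exists_affine_lift hG.mul_comm (ts 0)
    obtain ⟨f₂, hf₂, K₂, h₂⟩ := exists_affine_lift hG.mul_comm (ts 1)
    obtain ⟨f₃, hf₃, K₃, h₃⟩ := exists_affine_lift hG.mul_comm (ts 2)
    -- The extra `1` allows for the full turn within which the three shifted points lie.
    set N : ℕ := K₁ + K₂ + K₃ + 1 with hN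
    set I := Finset.Icc (-N : ℤ) N
    refine ⟨I.image (fun i : ℤ => f₁ - f₂ - fun _ => i • period) ∪
      (I ×ˢ I).image (fun q : ℤ × ℤ => f₂ - f₃ + fun _ => (q.1 - q.2) • period) ∪
      I.image (fun j : ℤ => f₃ - f₁ + fun _ => (j - 1) • period), ?_, ?_⟩
    · intro f hf
      simp only [Finset.mem_union, Finset.mem_image] at hf
      rcases hf with (⟨i, -, rfl⟩ | ⟨q, -, rfl⟩) | ⟨j, -, rfl⟩
      · exact sub_mem (sub_mem hf₁ hf₂) (const_mem_affine _)
      · exact add_mem (sub_mem hf₂ hf₃) (const_mem_affine _)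
      · exact add_mem (sub_mem hf₃ hf₁) (const_mem_affine _)
    · intro v v' x x' hv hv' hx hx' hs h
      have e₁ := h₁ _ (box hv hx)
      have e₂ := h₂ _ (box hv hx)
      have e₃ := h₃ _ (box hv hx)
      have e₁' := h₁ _ (box hv' hx')
      have e₂' := h₂ _ (box hv' hx')
      have e₃' := h₃ _ (box hv' hx')
      rw [elim] at e₁ e₂ e₃ e₁' e₂' e₃'
      have h : R ((ts 0).realize _) ((ts 1).realize _) ((ts 2).realize _) := h
      change R ((ts 0).realize _) ((ts 1).realize _) ((ts 2).realize _)
      rw [← e₁.1, ← e₂.1, ← e₃.1, R_val_iff] at h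
      rw [← e₁'.1, ← e₂'.1, ← e₃'.1, R_val_iff]
      obtain ⟨i, j, l₁, l₂, l₃⟩ := h
      set X := Sum.elim v x
      set X' := Sum.elim v' x'
      have hp := period_pos (G := G)
      have k₁ : 0 ≤ K₁ • (period : Unwound G) := nsmul_nonneg hp.le _
      have k₂ : 0 ≤ K₂ • (period : Unwound G) := nsmul_nonneg hp.le _
      have k₃ : 0 ≤ K₃ • (period : Unwound G) := nsmul_nonneg hp.le _
      have bound : ∀ (a b m : Unwound G), -(K₁ • period) ≤ a → a ≤ K₁ • period →
          -((K₂ + K₃) • period) ≤ b → b ≤ (K₂ + K₃) • period → a < b + m → b + m < a + period →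
          m ≤ N • period ∧ -(N • period) ≤ m := by
        intro a b m ha ha' hb hb' h h'
        rw [hN, add_smul, add_assoc, add_smul, one_smul]
        constructor
        · calc m = (b + m) + -b := by abel
            _ ≤ (a + period) + (K₂ + K₃) • period := add_le_add h'.le (neg_le.1 hb)
            _ ≤ (K₁ • period + period) + (K₂ + K₃) • period := by gcongr
            _ = _ := by abel
        · calc _ ≤ -(K₁ • (period : Unwound G)) + -((K₂ + K₃) • period) := by
                rw [← neg_add, neg_le_neg_iff]
                exact le_add_of_nonneg_right hp.le
            _ ≤ a + -b := add_le_add ha (neg_le_neg hb')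
            _ ≤ (b + m) + -b := by gcongr
            _ = m := by abel
      have hi : i ∈ I := by
        obtain ⟨b₁, b₂⟩ := bound _ (f₂ X) (i • period) e₁.2.1 e₁.2.2
          (le_trans (by rw [add_smul, neg_add]; exact add_le_of_nonpos_right (neg_nonpos.2 k₃))
            e₂.2.1)
          (e₂.2.2.trans (by rw [add_smul]; exact le_add_of_nonneg_right k₃)) l₁ (l₂.trans l₃)
        exact abs_le_of_zsmul_period_lt hG.mul_comm b₁ b₂
      have hj : j ∈ I := by
        obtain ⟨b₁, b₂⟩ := bound _ (f₃ X) (j • period) e₁.2.1 e₁.2.2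
          (le_trans (by rw [add_smul, neg_add]; exact add_le_of_nonpos_left (neg_nonpos.2 k₂))
            e₃.2.1)
          (e₃.2.2.trans (by rw [add_smul]; exact le_add_of_nonneg_left k₂)) (l₁.trans l₂) l₃
        exact abs_le_of_zsmul_period_lt hG.mul_comm b₁ b₂
      have s₁ := (hs _ (Finset.mem_union_left _ (Finset.mem_union_left _
        (Finset.mem_image_of_mem _ hi)))).neg_iff
      have s₂ := (hs _ (Finset.mem_union_left _ (Finset.mem_union_right _
        (Finset.mem_image_of_mem _ (Finset.mk_mem_product hi hj))))).neg_iff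
      have s₃ := (hs _ (Finset.mem_union_right _ (Finset.mem_image_of_mem _ hj))).neg_iff
      simp only [Pi.sub_apply, Pi.add_apply] at s₁ s₂ s₃
      have t₁ : ∀ a b c : Unwound G, a - b - c < 0 ↔ a < b + c := fun a b c => by
        rw [sub_sub, sub_neg]
      have t₂ : ∀ a b : Unwound G, a - b + (i - j) • period < 0 ↔
          a + i • period < b + j • period := fun a b => by
        rw [← sub_neg (a := a + i • period), sub_smul]
        have : a - b + (i • period - j • period) = a + i • period - (b + j • period) := by abel
        rw [this]
      have t₃ : ∀ a b : Unwound G, a - b + (j - 1) • period < 0 ↔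
          a + j • period < b + period := fun a b => by
        rw [← sub_neg (a := a + j • period), sub_smul, one_smul]
        have : a - b + (j • period - period) = a + j • period - (b + period) := by abel
        rw [this]
      rw [t₁, t₁] at s₁
      rw [t₂, t₂] at s₂
      rw [t₃, t₃] at s₃
      exact ⟨i, j, s₁.1 l₁, s₂.1 l₂, s₃.1 l₃⟩
  | imp φ ψ ihφ ihψ =>
    obtain ⟨F, hF, h⟩ := ihφ
    obtain ⟨F', hF', h'⟩ := ihψ
    refine ⟨F ∪ F', fun f hf => (Finset.mem_union.1 hf).elim (hF f) (hF' f), ?_⟩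
    intro v v' x x' hv hv' hx hx' hs hr hr'
    refine h' v v' x x' hv hv' hx hx' (fun f hf => hs f (Finset.mem_union_right _ hf)) (hr ?_)
    -- The hypothesis of the implication has to be carried backwards, which symmetry of `SameSign`
    -- permits.
    exact h v' v x' x hv' hv hx' hx (fun f hf => (hs f (Finset.mem_union_left _ hf)).symm) hr'
  | @all n φ ih =>
    obtain ⟨F, hF, h⟩ := ih
    have hdec : ∀ f ∈ affine (Unwound G) (α ⊕ Fin (n + 1)),
        ∃ g ∈ affine (Unwound G) (α ⊕ Fin n), ∃ k : ℤ, ∀ X y,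
          f (Sum.elim (X ∘ Sum.inl) (Fin.snoc (X ∘ Sum.inr) y)) = g X + k • y := by
      intro f hf
      refine affine_comp
        (fun X y => Sum.elim (X ∘ Sum.inl) (Fin.snoc (X ∘ Sum.inr) y)) ?_ hf
      rintro (i | i)
      · exact ⟨_, coord_mem_affine (Sum.inl i), 0, by simp⟩
      · refine Fin.lastCases ?_ (fun i => ?_) i
        · exact ⟨0, zero_mem _, 1, by simp⟩
        · exact ⟨_, coord_mem_affine (Sum.inr i), 0, by simp⟩
    set last : (α ⊕ Fin (n + 1) → Unwound G) → Unwound G := fun X => X (Sum.inr (Fin.last n))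
    -- The two added functions force the matched value of the variable to stay in `[0, period)`.
    set F₁ := F ∪ {last, last - fun _ => period} with hF₁
    have hF₁' : ∀ f ∈ F₁, f ∈ affine (Unwound G) (α ⊕ Fin (n + 1)) := by
      intro f hf
      simp only [hF₁, Finset.mem_union, Finset.mem_insert, Finset.mem_singleton] at hf
      rcases hf with hf | rfl | rfl
      · exact hF f hf
      · exact coord_mem_affine _
      · exact sub_mem (coord_mem_affine _) (const_mem_affine _)
    choose! g hg k hgk using fun f (hf : f ∈ F₁) => hdec f (hF₁' f hf)
    -- These are exactly the functions whose signs the matching lemma needs: constant parts and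
    -- cross differences.
    refine ⟨F₁.image g ∪ (F₁ ×ˢ F₁).image (fun q => k q.1 • g q.2 - k q.2 • g q.1), ?_, ?_⟩
    · intro f hf
      simp only [Finset.mem_union, Finset.mem_image, Finset.mem_product] at hf
      rcases hf with ⟨f, hf, rfl⟩ | ⟨q, ⟨hq, hq'⟩, rfl⟩
      · exact hg f hf
      · exact sub_mem (zsmul_mem (hg _ hq') _) (zsmul_mem (hg _ hq) _)
    · intro v v' x x' hv hv' hx hx' hs hr b
      have : Nontrivial (Unwound G) := ⟨0, period, period_pos.ne⟩
      have := hG.denselyOrdered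
      -- The challenge `b` lives on the primed side; it is carried back to a `y` at which the
      -- universal hypothesis can be used.
      obtain ⟨y, hy⟩ := exists_sameSign_matching hG.exists_zsmul_eq F₁ k
        (fun f => g f (Sum.elim v' x')) (fun f => g f (Sum.elim v x))
        (fun f hf => (hs _ (Finset.mem_union_left _ (Finset.mem_image_of_mem _ hf))).symm)
        (fun f hf f' hf' => (hs _ (Finset.mem_union_right _ (Finset.mem_image_of_mem _
          (Finset.mk_mem_product hf hf')))).symm) (lift b)
      have hy : ∀ f ∈ F₁, SameSign (f (Sum.elim v' (Fin.snoc x' (lift b))))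
          (f (Sum.elim v (Fin.snoc x y))) := by
        intro f hf
        have := hy f hf
        simpa only [← hgk f hf, Sum.elim_comp_inl, Sum.elim_comp_inr] using this
      have y0 : 0 ≤ y := by
        have := (hy last (by simp [hF₁])).nonneg_iff
        simpa [last, lift_nonneg] using this
      have y1 : y < period := by
        have := (hy (last - fun _ => period) (by simp [hF₁])).neg_iff
        simpa [last, lift_lt_period] using this
      have snoc : ∀ (x : Fin n → Unwound G) (y : Unwound G),
          (fun i => (Fin.snoc (α := fun _ => Unwound G) x y i).val) =
            Fin.snoc (α := fun _ => G) (fun i => (x i).val) y.val := by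
        intro x y
        funext i
        refine Fin.lastCases ?_ (fun i => ?_) i <;> simp
      have snocBox : ∀ (x : Fin n → Unwound G) (y : Unwound G), InBox x → 0 ≤ y → y < period →
          InBox (Fin.snoc (α := fun _ => Unwound G) x y) := by
        intro x y hx h0 h1 i
        refine Fin.lastCases ?_ (fun i => ?_) i
        · simpa using ⟨h0, h1⟩
        · simpa using hx i
      have := h v v' (Fin.snoc x y) (Fin.snoc x' (lift b)) hv hv' (snocBox x y hx y0 y1)
        (snocBox x' (lift b) hx' (lift_nonneg b) (lift_lt_period b))
        (fun f hf => (hy f (Finset.mem_union_left _ hf)).symm)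
      rw [snoc, snoc] at this
      exact this (hr y.val)

end Elimination

end CyclicallyOrderedGroup

/-! ### Divisible groups with torsion are cyclically minimal. -/

namespace CyclicallyOrderedGroup

open Unwound FirstOrder Language

section Characterization

variable {G : Type u} [CyclicallyOrderedGroup G]

/-- No point outside an arc which avoids `1` has its representative between those of two points of
the arc. -/
theorem not_le_lift_of_le {a b x y : G} {r : Unwound G} (hx : R a x b) (hy : R a y b)
    (h1 : ¬ R a 1 b) (hr : ¬ R a r.val b) (hxr : lift x ≤ r) : ¬ r ≤ lift y := by
  intro hry
  have e : lift r.val = r := lift_val_eq ((lift_nonneg x).trans hxr) (hry.trans_lt (lift_lt_period y))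
  rw [← e] at hxr hry
  have h0 : lift (1 : G) = 0 := rfl
  have a0 := lift_nonneg a
  have b0 := lift_nonneg b
  have x0 := lift_nonneg x
  have y0 := lift_nonneg y
  rw [← h0] at a0 b0 x0 y0
  clear e h0
  simp only [R_iff_lift] at *
  grind

theorem IsDivisibleWithTorsion.isCyclicallyMinimal (hG : IsDivisibleWithTorsion G) :
    IsCyclicallyMinimal G := by
  classical
  have hinf := hG.infinite
  refine ⟨hinf, fun D hD => ?_⟩
  obtain ⟨φ, hφ⟩ := Set.definable_iff_exists_formula_sum.1 hD
  let _ : AddCommGroup (Unwound G) := addCommGroup hG.mul_comm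
  have : IsOrderedAddMonoid (Unwound G) := { add_le_add_left := fun a b h c => by gcongr }
  obtain ⟨F, hF, h⟩ := hG.exists_sign_determined φ
  let V : Unwound G → ((Set.univ : Set G) ⊕ Fin 1) ⊕ Fin 0 → Unwound G := fun y =>
    Sum.elim (Sum.elim (fun a => lift a.1) (fun _ => y)) Fin.elim0
  -- With the parameters frozen, each function depends on the single variable `y`.
  have hdec : ∀ f ∈ F, ∃ c : Unwound G, ∃ k : ℤ, ∀ y, f (V y) = c + k • y := by
    intro f hf
    obtain ⟨g, -, k, e⟩ := affine_comp (κ := PEmpty.{1}) (fun _ y => V y) (by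
      rintro ((a | i) | i)
      · exact ⟨_, const_mem_affine (lift a.1), 0, by simp [V]⟩
      · exact ⟨0, zero_mem _, 1, by simp [V]⟩
      · exact i.elim0) (hF f hf)
    exact ⟨g PEmpty.elim, k, e _⟩
  choose! c k hck using hdec
  have hroot : ∀ f, ∃ r, k f ≠ 0 → k f • r = -c f := by
    intro f
    by_cases hk : k f = 0
    · exact ⟨0, fun h => absurd hk h⟩
    · obtain ⟨r, hr⟩ := hG.exists_zsmul_eq (k f) hk (-c f)
      exact ⟨r, fun _ => hr⟩
  choose r hr using hroot
  have mem_imp : ∀ x y : G,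
      (∀ f ∈ F, SameSign (c f + k f • lift x) (c f + k f • lift y)) → x ∈ D → y ∈ D := by
    intro x y hs hx
    have key := h (Sum.elim (fun a => lift a.1) (fun _ => lift x))
      (Sum.elim (fun a => lift a.1) (fun _ => lift y)) Fin.elim0 Fin.elim0
      (by rintro (a | i); exacts [⟨lift_nonneg _, lift_lt_period _⟩, ⟨lift_nonneg _, lift_lt_period _⟩])
      (by rintro (a | i); exacts [⟨lift_nonneg _, lift_lt_period _⟩, ⟨lift_nonneg _, lift_lt_period _⟩])
      (fun i => i.elim0) (fun i => i.elim0)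
      (fun f hf => by
        have := hs f hf
        rwa [← hck f hf, ← hck f hf] at this)
    have real : ∀ z : G, z ∈ D ↔ BoundedFormula.Realize φ
        (fun i => (Sum.elim (fun a : (Set.univ : Set G) => lift a.1) (fun _ : Fin 1 => lift z) i).val)
        (fun i => ((Fin.elim0 i : Unwound G)).val) := by
      intro z
      have h1 : z ∈ D ↔ (fun _ : Fin 1 => z) ∈ {v : Fin 1 → G | v 0 ∈ D} := Iff.rfl
      have h2 : (fun i => (Sum.elim (fun a : (Set.univ : Set G) => lift a.1)
          (fun _ : Fin 1 => lift z) i).val) = Sum.elim Subtype.val (fun _ => z) := by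
        funext i
        cases i <;> rfl
      rw [h1, hφ, h2]
      change Formula.Realize φ _ ↔ _
      rw [Formula.Realize, Subsingleton.elim (fun i : Fin 0 => _) (default : Fin 0 → G)]
    exact (real y).2 (key ((real x).1 hx))
  -- The breakpoints are the roots, the cut point `1`, and `g₀`, which serves only to have two
  -- distinct points.
  obtain ⟨g₀, hg₀⟩ := exists_ne (1 : G)
  refine isFiniteUnion_of_arcConst (P := (({1, g₀} ∪ F.image (fun f => (r f).val) : Finset G) : Set G))
    (Finset.finite_toSet _) ?_ ⟨1, by simp, g₀, by simp, hg₀.symm⟩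
  intro a b hab x y hx hy
  have same : ∀ f ∈ F, SameSign (c f + k f • lift x) (c f + k f • lift y) := by
    intro f hf
    by_cases hk : k f = 0
    · simp [hk, SameSign]
    have h1 := hab 1 (by simp)
    have hrf := hab (r f).val (by
      simp only [Finset.coe_union, Finset.coe_image]
      exact Or.inr ⟨f, hf, rfl⟩)
    have e : ∀ z, c f + k f • z = k f • (z - r f) := by
      intro z
      rw [smul_sub, hr f hk]; abel
    rw [e, e, sameSign_zsmul hk, sameSign_sub_iff]
    have l₁ := not_le_lift_of_le hx hy h1 hrf
    have l₂ := not_le_lift_of_le hy hx h1 hrf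
    rcases lt_or_ge (lift x) (r f) with h2 | h2
    · rw [(cmp_eq_lt_iff _ _).2 h2, (cmp_eq_lt_iff _ _).2 (not_le.1 fun h3 => l₁ h2.le h3)]
    · have h3 : r f < lift x := lt_of_le_of_ne h2 fun e => by
        rw [e] at hrf; exact hrf hx
      have h4 : r f < lift y := not_le.1 fun h4 => l₂ h4 h2
      rw [(cmp_eq_gt_iff _ _).2 h3, (cmp_eq_gt_iff _ _).2 h4]
  exact ⟨mem_imp x y same, mem_imp y x fun f hf => (same f hf).symm⟩

end Characterization

/-! ### Transfer along elementary equivalence and change of universe. -/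

section Transfer

theorem realize_commutative {G : Type u} [CyclicallyOrderedGroup G] :
    G ⊨ (∀' ∀' (mulTerm (.var (Sum.inr 0)) (.var (Sum.inr 1)) ='
      mulTerm (.var (Sum.inr 1)) (.var (Sum.inr 0))) : lang.Sentence) ↔
      ∀ a b : G, a * b = b * a := by
  simp [Sentence.Realize, Formula.Realize, Fin.snoc]

theorem realize_divisible {G : Type u} [CyclicallyOrderedGroup G] (p : ℕ) :
    G ⊨ (∀' ∃' (powTerm (.var (Sum.inr 1)) p =' .var (Sum.inr 0)) : lang.Sentence) ↔
      ∀ x : G, ∃ y, y ^ p = x := by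
  simp [Sentence.Realize, Formula.Realize, Fin.snoc]

theorem realize_torsion {G : Type u} [CyclicallyOrderedGroup G] (p : ℕ) :
    G ⊨ (∃' (∼(.var (Sum.inr 0) =' oneTerm) ⊓ (powTerm (.var (Sum.inr 0)) p =' oneTerm)) :
      lang.Sentence) ↔ ∃ x : G, x ≠ 1 ∧ x ^ p = 1 := by
  simp [Sentence.Realize, Formula.Realize, Fin.snoc]

theorem IsDivisibleWithTorsion.transfer {G : Type u} [CyclicallyOrderedGroup G] {G' : Type v}
    [CyclicallyOrderedGroup G'] (h : lang.ElementarilyEquivalent G G')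
    (hG : IsDivisibleWithTorsion G) : IsDivisibleWithTorsion G' := by
  have h := elementarilyEquivalent_iff.1 h
  exact
    { mul_comm := realize_commutative.1 ((h _).1 (realize_commutative.2 hG.mul_comm))
      exists_pow_eq := fun p hp =>
        (realize_divisible p).1 ((h _).1 ((realize_divisible p).2 (hG.exists_pow_eq p hp)))
      exists_torsion := fun p hp =>
        (realize_torsion p).1 ((h _).1 ((realize_torsion p).2 (hG.exists_torsion p hp))) }

/-- The cyclically ordered group structure induced along an injection whose range is closed under
the operations. -/
abbrev induced {G : Type u} [CyclicallyOrderedGroup G] {X : Type v} [Mul X] [One X] [Inv X]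
    (f : X → G) (hf : Function.Injective f) (one : f 1 = 1)
    (mul : ∀ x y, f (x * y) = f x * f y) (inv : ∀ x, f x⁻¹ = (f x)⁻¹) :
    CyclicallyOrderedGroup X where
  toGroup := Group.ofLeftAxioms (fun x y z => hf (by simp [mul, mul_assoc]))
    (fun x => hf (by simp [mul, one])) (fun x => hf (by simp [mul, one, inv]))
  R x y z := R (f x) (f y) (f z)
  strict x y z h := by
    obtain ⟨h1, h2, h3⟩ := R_ne h
    exact ⟨fun e => h1 (e ▸ rfl), fun e => h2 (e ▸ rfl), fun e => h3 (e ▸ rfl)⟩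
  cyclic x y z h := R_rot h
  linear g :=
    { trichotomous := fun x y h1 h2 => by
        by_contra hne
        have hxy : f x ≠ f y := fun e => hne (Subtype.ext (hf e))
        exact (R_total (fun e => x.2 (hf e).symm) hxy (fun e => y.2 (hf e).symm)).elim h1 h2
      irrefl := fun x h => (R_ne h).2.1 rfl
      trans := fun x y z h h' => R_trans h h' }
  compat x y z h k hR := by
    have := compat (f x) (f y) (f z) (f h) (f k) hR
    rw [← mul, ← mul, ← mul, ← mul, ← mul, ← mul] at this
    exact this

/-- An infinite cyclically ordered group is elementarily equivalent to one in any universe. -/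
theorem exists_elementarilyEquivalent (G : Type u) [CyclicallyOrderedGroup G] [Infinite G] :
    ∃ (G' : Type v) (_ : CyclicallyOrderedGroup G'), lang.ElementarilyEquivalent G G' := by
  have hF : Countable (Σ n, FuncSymb n) := by
    refine Function.Injective.countable
      (f := fun s : Σ n, FuncSymb n => s.1) ?_
    rintro ⟨n, s⟩ ⟨m, t⟩ h
    obtain rfl : n = m := h
    cases s <;> cases t <;> rfl
  have hR : Countable (Σ n, RelSymb n) := by
    refine Function.Injective.countable
      (f := fun s : Σ n, RelSymb n => s.1) ?_
    rintro ⟨n, s⟩ ⟨m, t⟩ h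
    obtain rfl : n = m := h
    cases s; cases t; rfl
  have hc : lang.card ≤ Cardinal.aleph0 := by
    have h1 : Countable (Σ n, lang.Functions n) := hF
    have h2 : Countable (Σ n, lang.Relations n) := hR
    have : Countable lang.Symbols := inferInstanceAs (Countable (_ ⊕ _))
    exact Cardinal.mk_le_aleph0
  -- Downward Löwenheim–Skolem gives a countable elementary substructure, whose structure is then
  -- copied onto `ULift ℕ`.
  obtain ⟨S, -, hS⟩ := exists_elementarySubstructure_card_eq lang (∅ : Set G)
    (Cardinal.aleph0.{0}) le_rfl (by simp) (by simpa using hc) (by simp)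
  have hS' : Cardinal.lift.{v} (Cardinal.mk S) = Cardinal.lift.{u} (Cardinal.mk (ULift.{v} ℕ)) := by
    simpa using hS
  obtain ⟨e⟩ := Cardinal.lift_mk_eq'.1 hS'
  let e := e.symm
  let f : ULift.{v} ℕ → G := fun x => e x
  have hf : Function.Injective f := fun x y h => e.injective (Subtype.ext h)
  have one_mem : (1 : G) ∈ S := S.toSubstructure.fun_mem FuncSymb.one ![] (by simp)
  have mul_mem : ∀ x y : S, (x * y : G) ∈ S := fun x y =>
    S.toSubstructure.fun_mem FuncSymb.mul ![x.1, y.1] (by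
      intro i; fin_cases i; exacts [x.2, y.2])
  have inv_mem : ∀ x : S, (x : G)⁻¹ ∈ S := fun x =>
    S.toSubstructure.fun_mem FuncSymb.inv ![x.1] (by
      intro i; fin_cases i; exact x.2)
  let _ : Mul (ULift.{v} ℕ) := ⟨fun x y => e.symm ⟨_, mul_mem (e x) (e y)⟩⟩
  let _ : One (ULift.{v} ℕ) := ⟨e.symm ⟨_, one_mem⟩⟩
  let _ : Inv (ULift.{v} ℕ) := ⟨fun x => e.symm ⟨_, inv_mem (e x)⟩⟩
  have h1 : f 1 = 1 := by
    change ((e (e.symm _) : S) : G) = _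
    rw [Equiv.apply_symm_apply]
  have hm : ∀ x y, f (x * y) = f x * f y := by
    intro x y
    change ((e (e.symm _) : S) : G) = _
    rw [Equiv.apply_symm_apply]
  have hi : ∀ x, f x⁻¹ = (f x)⁻¹ := by
    intro x
    change ((e (e.symm _) : S) : G) = _
    rw [Equiv.apply_symm_apply]
  let inst : CyclicallyOrderedGroup (ULift.{v} ℕ) := induced f hf h1 hm hi
  refine ⟨ULift.{v} ℕ, inst, ?_⟩
  let E : ULift.{v} ℕ ≃[lang] S :=
    { e with
      map_fun' := by
        intro n s x
        apply Subtype.ext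
        cases s with
        | one => exact h1
        | inv => exact hi _
        | mul => exact hm _ _
      map_rel' := by
        intro n r x
        cases r
        exact Iff.rfl }
  exact S.elementarilyEquivalent.symm.trans E.toElementaryEmbedding.elementarilyEquivalent.symm

end Transfer

end CyclicallyOrderedGroup

theorem corollary1p6 (G : Type u) [CyclicallyOrderedGroup G] :
    CyclicallyOrderedGroup.IsStronglyCyclicallyMinimal.{u, v} G ↔
      CyclicallyOrderedGroup.IsCyclicallyMinimal G := by
  open CyclicallyOrderedGroup in
  constructor
  · rintro ⟨hinf, h⟩
    -- `G` need not live in universe `v`, so minimality is tested on an equivalent group there and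
    -- the first-order list is carried back.
    obtain ⟨G', inst, hG'⟩ := exists_elementarilyEquivalent.{u, v} G
    exact ((h G' hG').isDivisibleWithTorsion.transfer hG'.symm).isCyclicallyMinimal
  · intro h
    exact ⟨h.1, fun G' _ hG' => (h.isDivisibleWithTorsion.transfer hG').isCyclicallyMinimal⟩
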